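/- **Setup.** Let $\mathbb F$ be a finite field with $|\mathbb F|=q$, let $\Omega$ be a nonempty finite set, let $\mathbf P=(\Omega,\preccurlyeq)$ be a poset, let $\omega:\Omega\to\mathbb R$ be a map with $\omega(i)>0$ for all $i$, let $(k_i)_{i\in\Omega}$ be positive integers, and put $\mathbf H=\prod_{i\in\Omega}\mathbb F^{k_i}$. Let $\overline{\mathbf P}$ be the dual poset, let $\operatorname{len}(y)$ be the largest cardinality of a chain in $\mathbf P$ with greatest element $y$, let $m$ be the largest cardinality of a chain in $\mathbf P$, and put $W_r=\{u\in\Omega:\operatorname{len}(u)=r\}$. The poset $\mathbf P$ is *hierarchical* if $\operatorname{len}(u)<\operatorname{len}(v)$ implies $u\preccurlyeq v$. An *ideal* of $\mathbf P$ is a down-closed subset of $\Omega$, and $\langle B\rangle_{\mathbf P}$ is the ideal generated by $B\subseteq\Omega$. For $\beta\in\mathbf H$ let $\operatorname{supp}(\beta)=\{i:\beta_i\ne0\}$ and $\operatorname{wt}_{(\mathbf P,\omega)}(\beta)=\sum_{i\in\langle\operatorname{supp}(\beta)\rangle_{\mathbf P}}\omega(i)$. A *$(\mathbf P,\omega)$-isometry*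 is an $\mathbb F$-linear automorphism of $\mathbf H$ that preserves $\operatorname{wt}_{(\mathbf P,\omega)}$. Let $\mathcal Q(\mathbf P,\omega)$ be the partition of $\mathbf H$ into the sets of vectors of equal $(\mathbf P,\omega)$-weight, and define $\mathcal Q(\overline{\mathbf P},\omega)$ likewise. Let $\langle\alpha,\beta\rangle=\sum_{i}\sum_{t=1}^{k_i}\alpha_{i,t}\beta_{i,t}$, and for a subspace $C\subseteq\mathbf H$ let $C^\perp=\{\beta\in\mathbf H:\langle\alpha,\beta\rangle=0\text{ for all }\alpha\in C\}$. Fix a nontrivial additive character $\chi:\mathbb F\to\mathbb C^\times$. For a partition $\Gamma$ of $\mathbf H$, let $l(\Gamma)$ be the partition in which $\alpha,\gamma$ are equivalent if and only if $\sum_{\beta\in B}\chi(\langle\alpha,\beta\rangle)=\sum_{\beta\in B}\chi(\langle\gamma,\beta\rangle)$ for all $B\in\Gamma$. **Theorem 6.5.** Consider the following statements. 1. (MacWilliams extension property) For every subspace $C\subseteq\mathbf H$, every $\mathbb F$-linear map $C\to\mathbf H$ that preserves $\operatorname{wt}_{(\mathbf P,\omega)}$ is the restriction to $C$ of a $(\mathbf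 P,\omega)$-isometry of $\mathbf H$. 2. For all $\gamma,\theta\in\mathbf H$ with $\operatorname{wt}_{(\mathbf P,\omega)}(\gamma)=\operatorname{wt}_{(\mathbf P,\omega)}(\theta)$ there is a $(\mathbf P,\omega)$-isometry $\psi$ of $\mathbf H$ with $\psi(\gamma)=\theta$. 3. (Condition (D)) For all ideals $I,J$ of $\mathbf P$ with $\sum_{i\in I}\omega(i)=\sum_{j\in J}\omega(j)$ there is an order automorphism $\lambda$ of $\mathbf P$ with $J=\lambda[I]$ and $\omega\circ\lambda=\omega$; and for all $u,v\in\Omega$ with $\operatorname{len}(u)=\operatorname{len}(v)$ and $\omega(u)=\omega(v)$ one has $\mathbb F^{k_u}\cong\mathbb F^{k_v}$ as $\mathbb F$-vector spaces. 4. $\mathcal Q(\overline{\mathbf P},\omega)=l(\mathcal Q(\mathbf P,\omega))$. 5. (MacWilliams identity) For any two subspaces $C_1,C_2\subseteq\mathbf H$: if $|C_1\cap B|=|C_2\cap B|$ for all $B\in\mathcal Q(\overline{\mathbf P},\omega)$, then $|C_1^\perp\cap B|=|C_2^\perp\cap B|$ for all $B\in\mathcal Q(\mathbf P,\omega)$.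 6. (Fourier-reflexivity) $l(l(\mathcal Q(\mathbf P,\omega)))=\mathcal Q(\mathbf P,\omega)$. 7. For every $r\in\{1,\dots,m\}$ and every $b\in\omega[W_r]$, either $k_i=1$ for all $i\in W_r$ with $\omega(i)=b$, or $|\{i\in W_r:\omega(i)=b\}|\le q$. Then $(1)\Rightarrow(2)$, $(2)\Leftrightarrow(3)$, $(3)\Rightarrow(4)$, $(4)\Leftrightarrow(5)$ and $(5)\Rightarrow(6)$. If $\mathbf P$ is hierarchical, then $(1)\Leftrightarrow\big((3)\wedge(7)\big)$. If $\mathbf P$ is hierarchical and $\omega$ is integer-valued, then (2)–(6) are all equivalent to each other. -/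

import Mathlib

namespace WeightedPoset

universe u v w

/-- The ideal of `P` generated by `B`. -/
def idealGen {Ω : Type u} (P : PartialOrder Ω) (B : Set Ω) : Set Ω :=
  {a | ∃ b ∈ B, P.le a b}

/-- `I` is an ideal (down-closed subset) of `P`. -/
def IsIdeal {Ω : Type u} (P : PartialOrder Ω) (I : Set Ω) : Prop :=
  ∀ b ∈ I, ∀ a, P.le a b → a ∈ I

/-- The dual poset, on the same ground set. -/
abbrev dualPoset {Ω : Type u} (P : PartialOrder Ω) : PartialOrder Ω where
  le x y := P.le y x
  lt x y := P.lt y x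
  lt_iff_le_not_ge x y := P.lt_iff_le_not_ge y x
  le_refl x := P.le_refl x
  le_trans x y z hxy hyz := P.le_trans z y x hyz hxy
  le_antisymm x y hxy hyx := P.le_antisymm x y hyx hxy

open Classical in
/-- The largest cardinality of a chain in `P` containing `y` as its greatest element. -/
noncomputable def len {Ω : Type u} [Fintype Ω] (P : PartialOrder Ω) (y : Ω) : ℕ :=
  (Finset.univ.filter (fun B : Finset Ω =>
    IsChain P.le (B : Set Ω) ∧ y ∈ B ∧ ∀ b ∈ B, P.le b y)).sup Finset.card

open Classical in
/-- The largest cardinality of a chain in `P`. -/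
noncomputable def maxChainCard {Ω : Type u} [Fintype Ω] (P : PartialOrder Ω) : ℕ :=
  (Finset.univ.filter (fun B : Finset Ω => IsChain P.le (B : Set Ω))).sup Finset.card

/-- The `r`-th level of `P`. -/
def level {Ω : Type u} [Fintype Ω] (P : PartialOrder Ω) (r : ℕ) : Set Ω :=
  {i | len P i = r}

def IsHierarchical {Ω : Type u} [Fintype Ω] (P : PartialOrder Ω) : Prop :=
  ∀ u v : Ω, len P u + 1 ≤ len P v → P.le u v

/-- The unique decomposition property. An order automorphism of `P` is a relation isomorphism
of `P.le` with itself. -/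
def UDP {Ω : Type u} (P : PartialOrder Ω) (ω : Ω → ℝ) : Prop :=
  ∀ I J : Finset Ω, IsIdeal P (I : Set Ω) → IsIdeal P (J : Set Ω) →
    ∑ i ∈ I, ω i = ∑ j ∈ J, ω j →
    ∃ l : P.le ≃r P.le, (J : Set Ω) = l '' (I : Set Ω) ∧ ∀ i, ω (l i) = ω i

section Modules

/-- The set of coordinates at which `β` does not vanish. -/
def supp {Ω : Type u} {H : Ω → Type v} [∀ i, AddCommGroup (H i)] (β : ∀ i, H i) : Set Ω :=
  {i | β i ≠ 0}

open Classical in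
/-- The `(P, ω)`-weight. -/
noncomputable def wt {Ω : Type u} [Fintype Ω] {H : Ω → Type v} [∀ i, AddCommGroup (H i)]
    (P : PartialOrder Ω) (ω : Ω → ℝ) (β : ∀ i, H i) : ℝ :=
  ∑ i ∈ Finset.univ.filter (fun i => i ∈ idealGen P (supp β)), ω i

/-- The `S`-module automorphism `φ` is a `(P, ω)`-weight isometry. -/
def IsWeightIsometry (S : Type w) [Ring S] {Ω : Type u} [Fintype Ω] {H : Ω → Type v}
    [∀ i, AddCommGroup (H i)] [∀ i, Module S (H i)]
    (P : PartialOrder Ω) (ω : Ω → ℝ) (φ : (∀ i, H i) ≃ₗ[S] (∀ i, H i)) : Prop :=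
  ∀ α, wt P ω (φ α) = wt P ω α

/-- The MacWilliams extension property for `(P, ω)`-weight. -/
def MEP (S : Type w) [Ring S] {Ω : Type u} [Fintype Ω] (H : Ω → Type v)
    [∀ i, AddCommGroup (H i)] [∀ i, Module S (H i)]
    (P : PartialOrder Ω) (ω : Ω → ℝ) : Prop :=
  ∀ (C : Submodule S (∀ i, H i)) (f : C →ₗ[S] (∀ i, H i)),
    (∀ α : C, wt P ω (f α) = wt P ω (α : ∀ i, H i)) →
    ∃ φ : (∀ i, H i) ≃ₗ[S] (∀ i, H i), IsWeightIsometry S P ω φ ∧ ∀ α : C, φ α = f α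

/-- The weight isometries act transitively on vectors of equal weight. -/
def IsometriesTransitive (S : Type w) [Ring S] {Ω : Type u} [Fintype Ω] (H : Ω → Type v)
    [∀ i, AddCommGroup (H i)] [∀ i, Module S (H i)]
    (P : PartialOrder Ω) (ω : Ω → ℝ) : Prop :=
  ∀ γ θ : (∀ i, H i), wt P ω γ = wt P ω θ →
    ∃ ψ : (∀ i, H i) ≃ₗ[S] (∀ i, H i), IsWeightIsometry S P ω ψ ∧ ψ γ = θ

/-- The UDP holds, and blocks of equal length and equal weight are isomorphic. -/
def ConditionD (S : Type w) [Ring S] {Ω : Type u} [Fintype Ω] (H : Ω → Type v)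
    [∀ i, AddCommGroup (H i)] [∀ i, Module S (H i)]
    (P : PartialOrder Ω) (ω : Ω → ℝ) : Prop :=
  UDP P ω ∧ ∀ u v : Ω, len P u = len P v → ω u = ω v → Nonempty (H u ≃ₗ[S] H v)

/-- The partition of the ambient space by `(P, ω)`-weight (as an equivalence relation, whose
classes are the members of the partition). -/
noncomputable def weightPartition {Ω : Type u} [Fintype Ω] (H : Ω → Type v) [∀ i, AddCommGroup (H i)]
    (P : PartialOrder Ω) (ω : Ω → ℝ) : Setoid (∀ i, H i) :=
  Setoid.ker (wt P ω)

end Modules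

section FiniteField

/-- The ambient space `∏ i, F ^ (k i)`. -/
abbrev Amb {Ω : Type u} (F : Type v) (k : Ω → ℕ) : Type (max u v) :=
  ∀ i : Ω, Fin (k i) → F

/-- The standard inner product. -/
def ip {Ω : Type u} [Fintype Ω] {F : Type v} [Field F] {k : Ω → ℕ} (α β : Amb F k) : F :=
  ∑ i, ∑ t, α i t * β i t

/-- The dual code. -/
def dualCode {Ω : Type u} [Fintype Ω] {F : Type v} [Field F] {k : Ω → ℕ}
    (C : Submodule F (Amb F k)) : Set (Amb F k) :=
  {β | ∀ α ∈ C, ip α β = 0}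

/-- `D₁` and `D₂` have the same `Γ`-distribution. -/
def SameDistribution {X : Type u} (Γ : Setoid X) (D₁ D₂ : Set X) : Prop :=
  ∀ B ∈ Γ.classes, (D₁ ∩ B).ncard = (D₂ ∩ B).ncard

/-- `(P, ω)` admits MacWilliams identity. -/
def AdmitsMacWilliamsIdentity {Ω : Type u} [Fintype Ω] (F : Type v) [Field F]
    (k : Ω → ℕ) (P : PartialOrder Ω) (ω : Ω → ℝ) : Prop :=
  ∀ C₁ C₂ : Submodule F (Amb F k),
    SameDistribution (weightPartition (fun i => Fin (k i) → F) (dualPoset P) ω)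
      (C₁ : Set (Amb F k)) (C₂ : Set (Amb F k)) →
    SameDistribution (weightPartition (fun i => Fin (k i) → F) P ω)
      (dualCode C₁) (dualCode C₂)

open Classical in
/-- `∑_{β ∈ B} χ(⟨α, β⟩)`. -/
noncomputable def charSum {Ω : Type u} [Fintype Ω] {F : Type v} [Field F] [Fintype F]
    {k : Ω → ℕ} (χ : AddChar F ℂ) (B : Set (Amb F k)) (α : Amb F k) : ℂ :=
  ∑ β ∈ Finset.univ.filter (fun β : Amb F k => β ∈ B), χ (ip α β)

/-- The dual partition `l(Γ)` with respect to the character `χ`. -/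
def dualPartition {Ω : Type u} [Fintype Ω] {F : Type v} [Field F] [Fintype F]
    {k : Ω → ℕ} (χ : AddChar F ℂ) (Γ : Setoid (Amb F k)) : Setoid (Amb F k) where
  r α γ := ∀ B ∈ Γ.classes, charSum χ B α = charSum χ B γ
  iseqv :=
    { refl := fun _ _ _ => rfl
      symm := fun h B hB => (h B hB).symm
      trans := fun h₁ h₂ B hB => (h₁ B hB).trans (h₂ B hB) }

def FourierReflexive {Ω : Type u} [Fintype Ω] {F : Type v} [Field F] [Fintype F]
    {k : Ω → ℕ} (χ : AddChar F ℂ) (Γ : Setoid (Amb F k)) : Prop :=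
  dualPartition χ (dualPartition χ Γ) = Γ

/-- In every level and for every value `b` of `ω` on it, either all the blocks of weight `b` in
that level have dimension one, or there are at most `|F|` of them. -/
def NumericCondition {Ω : Type u} [Fintype Ω] (F : Type v) [Fintype F]
    (k : Ω → ℕ) (P : PartialOrder Ω) (ω : Ω → ℝ) : Prop :=
  ∀ r : ℕ, 1 ≤ r → r ≤ maxChainCard P → ∀ b ∈ ω '' level P r,
    (∀ i ∈ level P r, ω i = b → k i = 1) ∨
      {i | i ∈ level P r ∧ ω i = b}.ncard ≤ Fintype.card F

end FiniteField

end WeightedPoset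

/-! An isometry carries the ideal generated by the support of a vector to another such ideal, so it
induces an order automorphism which preserves weights and dimensions. Conversely, an order
automorphism with these properties, corrected by a triangular map, realizes any prescribed
correspondence of supports. The adjoint of an isometry for the dual poset preserves weight for the
poset itself, so transitivity makes character sums over weight classes constant on dual weight
classes. As complementation matches ideals of the two posets, both partitions have equally many
classes, and no partition has more classes than its dual, so the two coincide. The MacWilliams
identity is Poisson summation; lines suffice to recover the equality of partitions from it.

For a hierarchical poset, the Fourier transform of `β ↦ exp (s * wt β)`, restricted to a level,
splits into one factor for each block, which depends only on its weight, its dimension and the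
vanishing of the block of the argument. The complex zeros in `s` of these factors recover the
nonvanishing blocks up to a permutation preserving weights and dimensions, for arbitrary positive
real weights.

For the extension property, a map with the same weights yields, on every level, two families of
subspaces of the code that contain each vector equally often. Since a vector space over a field with
`q` elements is not a union of `q` proper subspaces, these families agree up to order if there are
at most `q` of them, or if their members are hyperplanes. With `q + 1` blocks of dimension at least
two the kernels of the `q + 1` functionals on `F²` give a map that does not extend. -/

namespace WeightedPoset

open scoped Classical

section Order

variable {Ω : Type*} [Fintype Ω]

theorem card_le_len (P : PartialOrder Ω) {y : Ω} {B : Finset Ω} (hB : IsChain P.le (B : Set Ω))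
    (hy : IsGreatest (B : Set Ω) y) : B.card ≤ len P y :=
  Finset.le_sup (f := Finset.card) (Finset.mem_filter_univ _ |>.2 ⟨hB, hy⟩)

theorem exists_chain_card_eq_len (P : PartialOrder Ω) (y : Ω) :
    ∃ B : Finset Ω, IsChain P.le (B : Set Ω) ∧ IsGreatest (B : Set Ω) y ∧ B.card = len P y := by
  obtain ⟨B, hB, hcard⟩ := Finset.exists_mem_eq_sup
    ({B : Finset Ω | IsChain P.le (B : Set Ω) ∧ y ∈ B ∧ ∀ b ∈ B, b ≤ y} : Finset (Finset Ω))
    ⟨{y}, by simp⟩ Finset.card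
  have hB' := (Finset.mem_filter_univ _).1 hB
  exact ⟨B, hB'.1, hB'.2, hcard.symm⟩

theorem one_le_len (P : PartialOrder Ω) (y : Ω) : 1 ≤ len P y := by
  simpa using card_le_len P (B := {y}) (by simp) (by simp)

theorem len_le_maxChainCard (P : PartialOrder Ω) (y : Ω) : len P y ≤ maxChainCard P := by
  obtain ⟨B, hB, -, hcard⟩ := exists_chain_card_eq_len P y
  exact hcard ▸ Finset.le_sup (f := Finset.card) ((Finset.mem_filter_univ _).2 hB)

variable {P : PartialOrder Ω}

theorem len_strictMono : StrictMono (len P) := by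
  intro x y hxy
  obtain ⟨B, hB, hx, hcard⟩ := exists_chain_card_eq_len P x
  have hle : ∀ b ∈ B, b < y := fun b hb => (hx.2 hb).trans_lt hxy
  have hy : y ∉ B := fun h => (hle y h).false
  have hlen : (insert y B).card ≤ len P y := by
    refine card_le_len P ?_ ?_ <;> rw [Finset.coe_insert]
    · exact hB.insert fun b hb _ => Or.inr (hle b hb).le
    · exact ⟨Set.mem_insert y _, Set.forall_mem_insert.2 ⟨le_rfl, fun b hb => (hle b hb).le⟩⟩
  rw [Finset.card_insert_of_notMem hy, hcard] at hlen
  exact hlen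

theorem len_orderIso_apply (l : Ω ≃o Ω) (y : Ω) : len P (l y) = len P y := by
  have hle : ∀ (l : Ω ≃o Ω) (y : Ω), len P y ≤ len P (l y) := by
    intro l y
    obtain ⟨B, hB, hy, hcard⟩ := exists_chain_card_eq_len P y
    rw [← hcard, ← Finset.card_map l.toEquiv.toEmbedding]
    refine card_le_len P ?_ ?_ <;> rw [Finset.coe_map]
    · exact l.monotone.isChain_image hB
    · exact l.monotone.map_isGreatest hy
  exact (hle l y).antisymm' (by simpa using hle l.symm (l y))

theorem IsHierarchical.le_iff (hP : IsHierarchical P) {u v : Ω} :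
    u ≤ v ↔ u = v ∨ len P u < len P v := by
  rw [le_iff_eq_or_lt]
  exact or_congr_right ⟨fun h => len_strictMono h,
    fun h => lt_of_le_of_ne (hP u v h) fun e => h.ne (e ▸ rfl)⟩

/-- A length-preserving permutation of a hierarchical poset, as an order automorphism. -/
def IsHierarchical.orderIsoOfLen (hP : IsHierarchical P) (σ : Equiv.Perm Ω)
    (hσ : ∀ i, len P (σ i) = len P i) : Ω ≃o Ω where
  toEquiv := σ
  map_rel_iff' := by
    intro a b
    rw [hP.le_iff, hP.le_iff, hσ, hσ, σ.injective.eq_iff]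

/-- Uniqueness in Möbius inversion. -/
theorem eq_of_sum_le_eq {M : Type*} [AddCommMonoid M] [IsCancelAdd M] {f g : Ω → M}
    (h : ∀ i, ∑ j with j ≤ i, f j = ∑ j with j ≤ i, g j) : f = g := by
  funext i
  induction i using WellFoundedLT.induction with
  | ind i ih =>
    have hsplit : ∀ f : Ω → M, ∑ j with j ≤ i, f j = f i + ∑ j with j < i, f j := by
      intro f
      rw [← Finset.sum_insert (by simp)]
      congr 1
      ext j
      simp [le_iff_eq_or_lt]
    have hlt : ∑ j with j < i, f j = ∑ j with j < i, g j :=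
      Finset.sum_congr rfl fun j hj => ih j ((Finset.mem_filter_univ j).1 hj)
    have hi := h i
    rwa [hsplit, hsplit, hlt, add_left_inj] at hi

end Order

section Labels

variable {ι κ L : Type*}

theorem exists_perm_of_map_univ_eq [Fintype ι] {c d : ι → L}
    (h : Finset.univ.val.map c = Finset.univ.val.map d) :
    ∃ σ : Equiv.Perm ι, ∀ i, d (σ i) = c i := by
  have hfiber : ∀ l, Fintype.card {i // c i = l} = Fintype.card {i // d i = l} := by
    intro l
    have hl := congrArg (Multiset.count l) h
    rw [Multiset.count_map, Multiset.count_map] at hl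
    simp only [Fintype.card_subtype, eq_comm (b := l)]
    exact hl
  have e : ∀ l, {i // c i = l} ≃ {i // d i = l} := fun l => Fintype.equivOfCardEq (hfiber l)
  exact ⟨Equiv.ofFiberEquiv e, Equiv.ofFiberEquiv_map e⟩

theorem exists_perm_of_forall_map_eq [Fintype ι] {p : ι → κ} {c d : ι → L}
    (h : ∀ r, (Finset.univ.filter (p · = r)).val.map c = (Finset.univ.filter (p · = r)).val.map d) :
    ∃ σ : Equiv.Perm ι, ∀ i, p (σ i) = p i ∧ d (σ i) = c i := by
  have hmap : Finset.univ.val.map (fun i => (p i, c i)) =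
      Finset.univ.val.map (fun i => (p i, d i)) := by
    ext ⟨r, l⟩
    have hl := congrArg (Multiset.count l) (h r)
    simp only [Multiset.count_map, Finset.filter_val, Multiset.filter_filter] at hl
    simpa only [Multiset.count_map, Prod.mk.injEq, eq_comm, and_comm] using hl
  obtain ⟨σ, hσ⟩ := exists_perm_of_map_univ_eq hmap
  exact ⟨σ, fun i => Prod.mk.injEq _ _ _ _ ▸ hσ i⟩

theorem exists_perm_of_map_eq [Finite ι] {c : ι → L} {A B : Finset ι}
    (h : A.val.map c = B.val.map c) :
    ∃ σ : Equiv.Perm ι, (∀ i, c (σ i) = c i) ∧ ∀ i, σ i ∈ B ↔ i ∈ A := by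
  have := Fintype.ofFinite ι
  have huniv : ∀ A : Finset ι, Finset.univ.val = A.val + Aᶜ.val := fun A => by
    rw [← Finset.disjUnion_val A Aᶜ disjoint_compl_right, Finset.disjUnion_eq_union,
      Finset.union_compl]
  have hcompl : Aᶜ.val.map c = Bᶜ.val.map c := by
    have hAB := (congrArg (Multiset.map c) (huniv A)).symm.trans
      (congrArg (Multiset.map c) (huniv B))
    rwa [Multiset.map_add, Multiset.map_add, h, add_right_inj] at hAB
  have hsplit : ∀ A : Finset ι, Finset.univ.val.map (fun i => (c i, i ∈ A)) =
      (A.val.map c).map (·, True) + (Aᶜ.val.map c).map (·, False) := by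
    intro A
    rw [huniv A, Multiset.map_add, Multiset.map_map, Multiset.map_map]
    congr 1 <;> refine Multiset.map_congr rfl fun i hi => ?_
    · simpa using hi
    · simpa using hi
  obtain ⟨σ, hσ⟩ := exists_perm_of_map_univ_eq (c := fun i => (c i, i ∈ A))
    (d := fun i => (c i, i ∈ B)) (by rw [hsplit, hsplit, h, hcompl])
  simp only [Prod.mk.injEq, eq_iff_iff] at hσ
  exact ⟨σ, fun i => (hσ i).1, fun i => (hσ i).2⟩

theorem map_eq_map_of_cancel (c : ι → L) (d : κ → L) (R : Finset ι → Finset κ → Prop)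
    (step : ∀ S T, R S T → (S.Nonempty ∨ T.Nonempty) →
      ∃ i ∈ S, ∃ j ∈ T, c i = d j ∧ R (S.erase i) (T.erase j))
    {S : Finset ι} {T : Finset κ} (h : R S T) : S.val.map c = T.val.map d := by
  induction S using Finset.strongInduction generalizing T with
  | H S ih =>
    by_cases hne : S.Nonempty ∨ T.Nonempty
    · obtain ⟨i, hi, j, hj, hij, hR⟩ := step S T h hne
      have hcons := ih _ (Finset.erase_ssubset hi) hR
      rw [← Multiset.cons_erase (show i ∈ S.val from hi),
        ← Multiset.cons_erase (show j ∈ T.val from hj), Multiset.map_cons, Multiset.map_cons,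
        ← Finset.erase_val, ← Finset.erase_val, hcons, hij]
    · simp only [not_or, Finset.not_nonempty_iff_eq_empty] at hne
      simp [hne.1, hne.2]

end Labels

section PositiveWeights

variable {Ω : Type*} {ω : Ω → ℝ}

theorem sum_le_sum_of_subset_of_pos (hω : ∀ i, 0 < ω i) {A B : Finset Ω} (h : A ⊆ B) :
    ∑ i ∈ A, ω i ≤ ∑ i ∈ B, ω i :=
  Finset.sum_le_sum_of_subset_of_nonneg h fun i _ _ => (hω i).le

theorem eq_of_subset_of_sum_le (hω : ∀ i, 0 < ω i) {A B : Finset Ω} (h : A ⊆ B)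
    (hle : ∑ i ∈ B, ω i ≤ ∑ i ∈ A, ω i) : A = B := by
  by_contra hne
  obtain ⟨i, hiB, hiA⟩ := Finset.exists_of_ssubset (h.ssubset_of_ne hne)
  exact hle.not_gt (Finset.sum_lt_sum_of_subset h hiB hiA (hω i) fun j _ _ => (hω j).le)

theorem sum_eq_sum_of_perm (σ : Equiv.Perm Ω) (hσ : ∀ i, ω (σ i) = ω i) {A B : Finset Ω}
    (h : ∀ i, σ i ∈ B ↔ i ∈ A) : ∑ i ∈ A, ω i = ∑ i ∈ B, ω i :=
  Finset.sum_equiv σ (fun i => (h i).symm) fun i _ => (hσ i).symm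

theorem coe_eq_image_iff (σ : Equiv.Perm Ω) {A B : Finset Ω} :
    (B : Set Ω) = σ '' (A : Set Ω) ↔ ∀ i, σ i ∈ B ↔ i ∈ A :=
  (σ.preimage_eq_iff_eq_image B A).symm.trans Set.ext_iff

end PositiveWeights

section Weights

variable {Ω : Type*} [Fintype Ω] {H : Ω → Type*} [∀ i, AddCommGroup (H i)]
  {P : PartialOrder Ω} {ω : Ω → ℝ} {α β : ∀ i, H i}

/-- The ideal `⟨supp β⟩` of `P`, as a finite set. -/
noncomputable def suppIdeal (P : PartialOrder Ω) (β : ∀ i, H i) : Finset Ω :=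
  {i | i ∈ idealGen P (supp β)}

theorem mem_suppIdeal {i : Ω} : i ∈ suppIdeal P β ↔ ∃ b, β b ≠ 0 ∧ i ≤ b := by
  rw [suppIdeal, Finset.mem_filter_univ]
  rfl

theorem wt_eq_sum_suppIdeal (P : PartialOrder Ω) (ω : Ω → ℝ) (β : ∀ i, H i) :
    wt P ω β = ∑ i ∈ suppIdeal P β, ω i :=
  rfl

theorem mem_suppIdeal_self {i : Ω} (h : β i ≠ 0) : i ∈ suppIdeal P β :=
  mem_suppIdeal.2 ⟨i, h, le_rfl⟩

theorem mem_suppIdeal_iff_ne_zero {i : Ω} (h : ∀ j, i < j → α j = 0) :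
    i ∈ suppIdeal P α ↔ α i ≠ 0 := by
  refine ⟨fun hi => ?_, mem_suppIdeal_self⟩
  obtain ⟨b, hb, hib⟩ := mem_suppIdeal.1 hi
  obtain rfl | hlt := hib.eq_or_lt
  · exact hb
  · exact absurd (h b hlt) hb

theorem isIdeal_suppIdeal (P : PartialOrder Ω) (β : ∀ i, H i) :
    IsIdeal P (suppIdeal P β : Set Ω) := by
  intro j hj i hij
  obtain ⟨b, hb, hjb⟩ := mem_suppIdeal.1 hj
  exact mem_suppIdeal.2 ⟨b, hb, hij.trans hjb⟩

theorem mem_suppIdeal_of_le {i j : Ω} (hij : i ≤ j) (hj : j ∈ suppIdeal P β) :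
    i ∈ suppIdeal P β :=
  isIdeal_suppIdeal P β j hj i hij

theorem suppIdeal_subset_iff {I : Finset Ω} (hI : IsIdeal P (I : Set Ω)) :
    suppIdeal P β ⊆ I ↔ ∀ i, β i ≠ 0 → i ∈ I := by
  refine ⟨fun h i hi => h (mem_suppIdeal_self hi), fun h i hi => ?_⟩
  obtain ⟨b, hb, hib⟩ := mem_suppIdeal.1 hi
  exact hI b (h b hb) i hib

theorem suppIdeal_congr (h : ∀ i, α i = 0 ↔ β i = 0) : suppIdeal P α = suppIdeal P β := by
  ext i
  simp only [mem_suppIdeal, ne_eq, h]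

theorem suppIdeal_eq_empty : suppIdeal P β = ∅ ↔ β = 0 := by
  constructor
  · intro h
    ext i
    by_contra hi
    exact Finset.notMem_empty i (h ▸ mem_suppIdeal_self (P := P) hi)
  · rintro rfl
    ext i
    simp [mem_suppIdeal]

theorem wt_congr (P : PartialOrder Ω) (ω : Ω → ℝ) (h : ∀ i, α i = 0 ↔ β i = 0) :
    wt P ω α = wt P ω β := by
  rw [wt_eq_sum_suppIdeal, wt_eq_sum_suppIdeal, suppIdeal_congr h]

theorem wt_zero (P : PartialOrder Ω) (ω : Ω → ℝ) : wt P ω (0 : ∀ i, H i) = 0 := by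
  rw [wt_eq_sum_suppIdeal, suppIdeal_eq_empty.2 rfl, Finset.sum_empty]

theorem wt_neg (P : PartialOrder Ω) (ω : Ω → ℝ) (α : ∀ i, H i) : wt P ω (-α) = wt P ω α :=
  wt_congr P ω fun i => by simp only [Pi.neg_apply, neg_eq_zero]

theorem wt_smul {S : Type*} [DivisionRing S] [∀ i, Module S (H i)] (P : PartialOrder Ω)
    (ω : Ω → ℝ) {c : S} (hc : c ≠ 0) (α : ∀ i, H i) : wt P ω (c • α) = wt P ω α :=
  wt_congr P ω fun i => by simp only [Pi.smul_apply, smul_eq_zero, hc, false_or]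

theorem wt_mono (hω : ∀ i, 0 < ω i) (h : suppIdeal P α ⊆ suppIdeal P β) :
    wt P ω α ≤ wt P ω β :=
  sum_le_sum_of_subset_of_pos hω h

theorem suppIdeal_eq_of_subset_of_wt_le (hω : ∀ i, 0 < ω i)
    (h : suppIdeal P α ⊆ suppIdeal P β) (hle : wt P ω β ≤ wt P ω α) :
    suppIdeal P α = suppIdeal P β :=
  eq_of_subset_of_sum_le hω h hle

theorem wt_eq_zero (hω : ∀ i, 0 < ω i) : wt P ω α = 0 ↔ α = 0 := by
  refine ⟨fun h => ?_, fun h => h ▸ wt_zero P ω⟩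
  rw [← suppIdeal_eq_empty (P := P)]
  exact (eq_of_subset_of_sum_le hω (Finset.empty_subset _)
    (by rw [Finset.sum_empty]; exact h.le)).symm

theorem wt_eq_of_perm (σ : Equiv.Perm Ω) (hσ : ∀ i, ω (σ i) = ω i)
    (h : ∀ i, σ i ∈ suppIdeal P β ↔ i ∈ suppIdeal P α) : wt P ω α = wt P ω β :=
  sum_eq_sum_of_perm σ hσ h

theorem exists_suppIdeal_eq [∀ i, Nontrivial (H i)] {I : Finset Ω}
    (hI : IsIdeal P (I : Set Ω)) :
    ∃ β : ∀ i, H i, (∀ i, β i ≠ 0 ↔ i ∈ I) ∧ suppIdeal P β = I := by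
  choose e he using fun i => exists_ne (0 : H i)
  have hsupp : ∀ i, (if i ∈ I then e i else 0) ≠ 0 ↔ i ∈ I := fun i => by simp [he]
  refine ⟨fun i => if i ∈ I then e i else 0, hsupp, Finset.Subset.antisymm ?_ fun i hi => ?_⟩
  · exact (suppIdeal_subset_iff hI).2 fun i => (hsupp i).1
  · exact mem_suppIdeal_self ((hsupp i).2 hi)

end Weights

section Isometries

theorem exists_comp_eq_of_ker_le {F X Y Z : Type*} [Field F] [AddCommGroup X] [Module F X]
    [AddCommGroup Y] [Module F Y] [AddCommGroup Z] [Module F Z] {a : X →ₗ[F] Z} {b : X →ₗ[F] Y}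
    (h : LinearMap.ker a ≤ LinearMap.ker b) : ∃ L : Z →ₗ[F] Y, L ∘ₗ a = b := by
  obtain ⟨L, hL⟩ :=
    ((LinearMap.ker a).liftQ b h ∘ₗ a.quotKerEquivRange.symm.toLinearMap).exists_extend
  refine ⟨L, LinearMap.ext fun x => ?_⟩
  have hx := LinearMap.congr_fun hL ⟨a x, x, rfl⟩
  rwa [LinearMap.comp_apply, LinearMap.comp_apply, LinearEquiv.coe_coe,
    LinearMap.quotKerEquivRange_symm_apply_image a x ⟨x, rfl⟩] at hx

theorem exists_linearEquiv_comp_eq_of_ker_eq {F X Y Z : Type*} [Field F] [AddCommGroup X]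
    [Module F X] [AddCommGroup Y] [Module F Y] [AddCommGroup Z] [Module F Z]
    [FiniteDimensional F Z] (e : Z ≃ₗ[F] Y) {a : X →ₗ[F] Z} {b : X →ₗ[F] Y}
    (h : LinearMap.ker a = LinearMap.ker b) : ∃ g : Z ≃ₗ[F] Y, ∀ x, g (a x) = b x := by
  let b' := e.symm.toLinearMap ∘ₗ b
  have hker : LinearMap.ker a = LinearMap.ker b' := by
    rw [h, LinearMap.ker_comp_of_ker_eq_bot _ e.symm.ker]
  obtain ⟨g, hg⟩ := Submodule.exists_linearEquiv_restrict_eq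
    (a.quotKerEquivRange.symm ≪≫ₗ Submodule.quotEquivOfEq _ _ hker ≪≫ₗ b'.quotKerEquivRange)
  refine ⟨g ≪≫ₗ e, fun x => ?_⟩
  have hx := hg (a.quotKerEquivRange (Submodule.Quotient.mk x))
  rw [LinearEquiv.trans_apply, LinearEquiv.trans_apply, LinearEquiv.symm_apply_apply,
    Submodule.quotEquivOfEq_mk, LinearMap.quotKerEquivRange_apply_mk,
    LinearMap.quotKerEquivRange_apply_mk] at hx
  rw [LinearEquiv.trans_apply, ← hx]
  exact e.apply_symm_apply (b x)

variable {Ω : Type*} [Fintype Ω] {F : Type*} [Field F] {H : Ω → Type*}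
  [∀ i, AddCommGroup (H i)] [∀ i, Module F (H i)] {P : PartialOrder Ω} {ω : Ω → ℝ}

theorem exists_isometry_of_wt [∀ i, FiniteDimensional F (H i)] (hω : ∀ i, 0 < ω i)
    (φ : (∀ i, H i) →ₗ[F] (∀ i, H i)) (h : ∀ α, wt P ω (φ α) = wt P ω α) :
    ∃ ψ : (∀ i, H i) ≃ₗ[F] (∀ i, H i), IsWeightIsometry F P ω ψ ∧ ∀ α, ψ α = φ α := by
  have hinj : Function.Injective φ := (injective_iff_map_eq_zero φ).2 fun α hα =>
    (wt_eq_zero (P := P) hω).1 (by rw [← h, hα, wt_zero])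
  exact ⟨LinearEquiv.ofInjectiveEndo φ hinj, h, fun _ => rfl⟩

variable {X : Type*} [AddCommGroup X] [Module F X] {a b : X →ₗ[F] (∀ i, H i)}

theorem MEP.exists_isometry (h : MEP F H P ω) (hω : ∀ i, 0 < ω i)
    (hab : ∀ x, wt P ω (b x) = wt P ω (a x)) :
    ∃ ψ : (∀ i, H i) ≃ₗ[F] (∀ i, H i), IsWeightIsometry F P ω ψ ∧ ∀ x, ψ (a x) = b x := by
  obtain ⟨f, hf⟩ := exists_comp_eq_of_ker_le (a := a.rangeRestrict) (b := b) fun x hx => by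
    rw [LinearMap.ker_rangeRestrict, LinearMap.mem_ker] at hx
    rw [LinearMap.mem_ker, ← wt_eq_zero (P := P) hω, hab, hx, wt_zero]
  have hf' : ∀ x, f (a.rangeRestrict x) = b x := LinearMap.congr_fun hf
  obtain ⟨ψ, hψ, hψf⟩ := h (LinearMap.range a) f fun y => by
    obtain ⟨x, rfl⟩ := a.surjective_rangeRestrict y
    exact (congrArg (wt P ω) (hf' x)).trans (hab x)
  exact ⟨ψ, hψ, fun x => (hψf (a.rangeRestrict x)).trans (hf' x)⟩

theorem transitive_of_MEP (hω : ∀ i, 0 < ω i) (h : MEP F H P ω) :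
    IsometriesTransitive F H P ω := by
  intro γ θ hγθ
  obtain ⟨ψ, hψ, hψγ⟩ := h.exists_isometry (a := LinearMap.toSpanSingleton F _ γ)
    (b := LinearMap.toSpanSingleton F _ θ) hω fun c => by
      rw [LinearMap.toSpanSingleton_apply, LinearMap.toSpanSingleton_apply]
      obtain rfl | hc := eq_or_ne c 0
      · rw [zero_smul, zero_smul]
      · rw [wt_smul P ω hc, wt_smul P ω hc, hγθ]
  exact ⟨ψ, hψ, by simpa using hψγ 1⟩

theorem mem_suppIdeal_of_triangular (s : Ω ≃o Ω) {α β : ∀ i, H i}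
    (h : ∀ i, (∀ j, s i < j → α j = 0) → (β i = 0 ↔ α (s i) = 0)) (i : Ω) :
    s i ∈ suppIdeal P α ↔ i ∈ suppIdeal P β := by
  constructor
  · intro hi
    obtain ⟨c, hc, hic⟩ := mem_suppIdeal.1 hi
    obtain ⟨b, hcb, hb⟩ := Finite.exists_le_maximal (p := fun j => α j ≠ 0) hc
    obtain ⟨b, rfl⟩ := s.surjective b
    have habove : ∀ j, s b < j → α j = 0 := fun j hj => not_not.1 (hb.not_prop_of_gt hj)
    exact mem_suppIdeal.2 ⟨b, (h b habove).not.2 hb.prop, s.le_iff_le.1 (hic.trans hcb)⟩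
  · intro hi
    obtain ⟨b, hb, hib⟩ := mem_suppIdeal.1 hi
    refine mem_suppIdeal_of_le (s.monotone hib) ?_
    by_contra hsb
    have hzero : ∀ j, s b ≤ j → α j = 0 := fun j hj =>
      not_not.1 fun hne => hsb (mem_suppIdeal.2 ⟨j, hne, hj⟩)
    exact hb ((h b fun j hj => hzero j hj.le).2 (hzero _ le_rfl))

theorem eq_zero_iff_of_mem_suppIdeal_iff (s : Ω ≃o Ω) {α β : ∀ i, H i}
    (hs : ∀ i, s i ∈ suppIdeal P α ↔ i ∈ suppIdeal P β) {i : Ω} (h : ∀ j, s i < j → α j = 0) :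
    α (s i) = 0 ↔ β i = 0 := by
  have hβ : ∀ j, i < j → β j = 0 := by
    intro j hij
    by_contra hj
    obtain ⟨b, hb, hjb⟩ := mem_suppIdeal.1 ((hs j).2 (mem_suppIdeal_self hj))
    exact hb (h b ((s.lt_iff_lt.2 hij).trans_le hjb))
  rw [← not_iff_not, ← ne_eq, ← ne_eq, ← mem_suppIdeal_iff_ne_zero h,
    ← mem_suppIdeal_iff_ne_zero hβ, hs]

/-- One row of a triangular isometry carrying `a x` to `b x`. -/
theorem exists_triangular_row (s : Ω ≃o Ω)
    (hs : ∀ x i, s i ∈ suppIdeal P (a x) ↔ i ∈ suppIdeal P (b x)) {i : Ω}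
    [FiniteDimensional F (H (s i))] (e : H (s i) ≃ₗ[F] H i) :
    ∃ g : H (s i) ≃ₗ[F] H i, ∃ N : (∀ i, H i) →ₗ[F] H i,
      (∀ α : ∀ i, H i, (∀ j, s i < j → α j = 0) → N α = 0) ∧
      ∀ x, g (a x (s i)) + N (a x) = b x i := by
  let above : (∀ i, H i) →ₗ[F] (∀ j : Set.Ioi (s i), H j) :=
    LinearMap.pi fun j => LinearMap.proj j.1
  have habove (α : ∀ i, H i) : above α = 0 ↔ ∀ j, s i < j → α j = 0 :=
    funext_iff.trans Subtype.forall
  let K := LinearMap.ker (above ∘ₗ a)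
  obtain ⟨g, hg⟩ := exists_linearEquiv_comp_eq_of_ker_eq e
    (a := (LinearMap.proj (s i) ∘ₗ a).domRestrict K) (b := (LinearMap.proj i ∘ₗ b).domRestrict K)
    (Submodule.ext fun x => eq_zero_iff_of_mem_suppIdeal_iff s (hs x) ((habove _).1 x.2))
  obtain ⟨L, hL⟩ := exists_comp_eq_of_ker_le (a := above ∘ₗ a)
    (b := LinearMap.proj i ∘ₗ b - g.toLinearMap ∘ₗ LinearMap.proj (s i) ∘ₗ a)
    fun x hx => sub_eq_zero.2 (hg ⟨x, hx⟩).symm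
  refine ⟨g, L ∘ₗ above, fun α hα => ?_, fun x => ?_⟩
  · rw [LinearMap.comp_apply, (habove α).2 hα, map_zero]
  · rw [show (L ∘ₗ above) (a x) = b x i - g (a x (s i)) from LinearMap.congr_fun hL x,
      add_sub_cancel]

theorem exists_isometry_of_mem_suppIdeal_iff [∀ i, FiniteDimensional F (H i)]
    (hω : ∀ i, 0 < ω i) (s : Ω ≃o Ω) (hsω : ∀ i, ω (s i) = ω i) (e : ∀ i, H (s i) ≃ₗ[F] H i)
    (hs : ∀ x i, s i ∈ suppIdeal P (a x) ↔ i ∈ suppIdeal P (b x)) :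
    ∃ ψ : (∀ i, H i) ≃ₗ[F] (∀ i, H i), IsWeightIsometry F P ω ψ ∧ ∀ x, ψ (a x) = b x := by
  choose g N hN hgN using fun i => exists_triangular_row (i := i) s hs (e i)
  obtain ⟨ψ, hψ, hψ'⟩ := exists_isometry_of_wt (P := P) hω
    (LinearMap.pi fun i => (g i).toLinearMap ∘ₗ LinearMap.proj (s i) + N i) fun α =>
      wt_eq_of_perm s.toEquiv hsω (mem_suppIdeal_of_triangular s fun i hi => by simp [hN i α hi])
  exact ⟨ψ, hψ, fun x => (hψ' _).trans (funext fun i => hgN i x)⟩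

theorem transitive_of_conditionD [∀ i, FiniteDimensional F (H i)] (hω : ∀ i, 0 < ω i)
    (h : ConditionD F H P ω) : IsometriesTransitive F H P ω := by
  intro γ θ hγθ
  obtain ⟨s, hθγ, hsω⟩ : ∃ s : Ω ≃o Ω, _ ∧ _ :=
    h.1 (suppIdeal P θ) (suppIdeal P γ) (isIdeal_suppIdeal P θ) (isIdeal_suppIdeal P γ) hγθ.symm
  have hs := (coe_eq_image_iff s.toEquiv).1 hθγ
  obtain ⟨ψ, hψ, hψγ⟩ := exists_isometry_of_mem_suppIdeal_iff
    (a := LinearMap.toSpanSingleton F _ γ) (b := LinearMap.toSpanSingleton F _ θ) hω s hsω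
    (fun i => (h.2 (s i) i (len_orderIso_apply s i) (hsω i)).some) fun c i => by
      obtain rfl | hc := eq_or_ne c 0
      · simp [mem_suppIdeal]
      · simpa [mem_suppIdeal, hc] using hs i
  exact ⟨ψ, hψ, by simpa using hψγ 1⟩

end Isometries

section Principal

theorem isGreatest_supp_single {Ω : Type*} {H : Ω → Type*} [∀ i, AddCommGroup (H i)]
    {P : PartialOrder Ω} {i : Ω} {x : H i} (hx : x ≠ 0) :
    IsGreatest (supp (Pi.single i x)) i := by
  refine ⟨show Pi.single i x i ≠ 0 by rwa [Pi.single_eq_same], fun b hb => ?_⟩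
  by_contra hbi
  exact hb (Pi.single_eq_of_ne (fun e => hbi e.le) x)

variable {Ω : Type*} [Fintype Ω] {H : Ω → Type*} [∀ i, AddCommGroup (H i)]
  {P : PartialOrder Ω} {ω : Ω → ℝ} {α β : ∀ i, H i} {i j : Ω}

theorem mem_suppIdeal_iff_le (h : IsGreatest (supp α) i) : j ∈ suppIdeal P α ↔ j ≤ i := by
  refine ⟨fun hj => ?_, fun hj => mem_suppIdeal.2 ⟨i, h.1, hj⟩⟩
  obtain ⟨b, hb, hjb⟩ := mem_suppIdeal.1 hj
  exact hjb.trans (h.2 hb)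

theorem suppIdeal_subset_of_mem (h : IsGreatest (supp β) i) (hi : i ∈ suppIdeal P α) :
    suppIdeal P β ⊆ suppIdeal P α :=
  fun _ hj => mem_suppIdeal_of_le ((mem_suppIdeal_iff_le h).1 hj) hi

theorem wt_eq_sum_le (h : IsGreatest (supp α) i) : wt P ω α = ∑ j with j ≤ i, ω j := by
  rw [wt_eq_sum_suppIdeal]
  congr 1
  ext j
  rw [mem_suppIdeal_iff_le h, Finset.mem_filter_univ]

theorem le_iff_wt_add_le (hω : ∀ i, 0 < ω i) (hα : IsGreatest (supp α) i)
    (hβ : IsGreatest (supp β) j) : j ≤ i ↔ wt P ω β ≤ wt P ω α ∧ wt P ω (α + β) ≤ wt P ω α := by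
  constructor
  · intro hji
    have hsub := suppIdeal_subset_of_mem hβ ((mem_suppIdeal_iff_le hα).2 hji)
    refine ⟨wt_mono hω hsub, wt_mono hω ?_⟩
    refine (suppIdeal_subset_iff (isIdeal_suppIdeal P α)).2 fun b hb => ?_
    by_contra hbα
    have hαb : α b = 0 := not_not.1 fun h => hbα (mem_suppIdeal_self h)
    have hβb : β b = 0 := not_not.1 fun h => hbα (hsub (mem_suppIdeal_self h))
    exact hb (by rw [Pi.add_apply, hαb, hβb, add_zero])
  · rintro ⟨hle, hadd⟩
    by_contra hji
    by_cases hij : i ≤ j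
    · have hsub := suppIdeal_subset_of_mem hα ((mem_suppIdeal_iff_le hβ).2 hij)
      have heq := suppIdeal_eq_of_subset_of_wt_le hω hsub hle
      exact hji ((mem_suppIdeal_iff_le hα).1 (heq ▸ mem_suppIdeal_self hβ.1))
    · have hαj : α j = 0 := not_not.1 fun h => hji (hα.2 h)
      have hβi : β i = 0 := not_not.1 fun h => hij (hβ.2 h)
      have hi : (α + β) i ≠ 0 := by rw [Pi.add_apply, hβi, add_zero]; exact hα.1
      have hj : (α + β) j ≠ 0 := by rw [Pi.add_apply, hαj, zero_add]; exact hβ.1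
      have hsub := suppIdeal_subset_of_mem hα (mem_suppIdeal_self (P := P) hi)
      have heq := suppIdeal_eq_of_subset_of_wt_le hω hsub hadd
      exact hji ((mem_suppIdeal_iff_le hα).1 (heq ▸ mem_suppIdeal_self hj))

theorem exists_isGreatest_supp_iff {F : Type*} [Field F] [∀ i, Module F (H i)]
    (hω : ∀ i, 0 < ω i) : (∃ i, IsGreatest (supp α) i) ↔
      α ∉ Submodule.span F {β : ∀ i, H i | wt P ω β < wt P ω α} := by
  constructor
  · rintro ⟨i, hi⟩ hα
    have hker : Submodule.span F {β : ∀ i, H i | wt P ω β < wt P ω α} ≤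
        LinearMap.ker (LinearMap.proj (R := F) (φ := H) i) := by
      refine Submodule.span_le.2 fun β hβ => ?_
      by_contra hβi
      exact hβ.not_ge (wt_mono hω (suppIdeal_subset_of_mem hi (mem_suppIdeal_self hβi)))
    exact hi.1 (hker hα)
  · intro hα
    by_contra hno
    refine hα (Finset.univ_sum_single α ▸ Submodule.sum_mem _ fun i _ => ?_)
    rw [Finset.univ_sum_single]
    obtain hi | hi := eq_or_ne (α i) 0
    · simp only [hi, Pi.single_zero, zero_mem]
    · refine Submodule.subset_span (Set.mem_ofPred.2 <| not_le.1 fun hge =>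
        hno ⟨i, hi, fun b hb => ?_⟩)
      have hsingle := isGreatest_supp_single (P := P) hi
      have heq := suppIdeal_eq_of_subset_of_wt_le hω
        (suppIdeal_subset_of_mem hsingle (mem_suppIdeal_self (P := P) hi)) hge
      exact (mem_suppIdeal_iff_le hsingle).1 (heq ▸ mem_suppIdeal_self hb)

theorem eq_comp_orderIso_of_sum_le_eq {M : Type*} [AddCommMonoid M] [IsCancelAdd M] {f : Ω → M}
    (l : Ω ≃o Ω) (h : ∀ i, ∑ j with j ≤ l i, f j = ∑ j with j ≤ i, f j) (i : Ω) :
    f (l i) = f i := by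
  refine congrFun (eq_of_sum_le_eq (P := P) (f := fun i => f (l i)) fun i => ?_) i
  rw [← h i]
  exact Finset.sum_equiv l.toEquiv (by simp) fun _ _ => rfl

end Principal

section InducedAutomorphism

variable {Ω : Type*} [Fintype Ω] {F : Type*} [Field F] {H : Ω → Type*}
  [∀ i, AddCommGroup (H i)] [∀ i, Module F (H i)] {P : PartialOrder Ω} {ω : Ω → ℝ}
  {φ : (∀ i, H i) ≃ₗ[F] (∀ i, H i)}

namespace IsWeightIsometry

theorem exists_isGreatest_supp (hφ : IsWeightIsometry F P ω φ) (hω : ∀ i, 0 < ω i)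
    {α : ∀ i, H i} {i : Ω} (h : IsGreatest (supp α) i) : ∃ j, IsGreatest (supp (φ α)) j := by
  have himage : {β : ∀ i, H i | wt P ω β < wt P ω (φ α)} =
      φ.toLinearMap '' {β | wt P ω β < wt P ω α} := by
    ext β
    obtain ⟨β, rfl⟩ := φ.surjective β
    rw [LinearEquiv.coe_coe, φ.injective.mem_set_image, Set.mem_ofPred_eq, Set.mem_ofPred_eq,
      hφ, hφ]
  rw [exists_isGreatest_supp_iff (F := F) hω, himage, Submodule.span_image]
  rintro ⟨β, hβ, hβα⟩
  exact (exists_isGreatest_supp_iff (F := F) hω).1 ⟨i, h⟩ (φ.injective hβα ▸ hβ)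

theorem exists_orderIso [∀ i, Nontrivial (H i)] (hφ : IsWeightIsometry F P ω φ)
    (hω : ∀ i, 0 < ω i) : ∃ l : Ω ≃o Ω, ∀ (α : ∀ i, H i) i,
      IsGreatest (supp α) i → IsGreatest (supp (φ α)) (l i) := by
  have hle : ∀ {α β : ∀ i, H i} {i j i' j' : Ω}, IsGreatest (supp α) i → IsGreatest (supp β) j →
      IsGreatest (supp (φ α)) i' → IsGreatest (supp (φ β)) j' → (j' ≤ i' ↔ j ≤ i) := by
    intro α β i j i' j' hα hβ hα' hβ'
    rw [le_iff_wt_add_le hω hα hβ, le_iff_wt_add_le hω hα' hβ', hφ, hφ, ← map_add, hφ]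
  choose e he using fun i => exists_ne (0 : H i)
  have hsingle : ∀ i, IsGreatest (supp (Pi.single i (e i))) i := fun i =>
    isGreatest_supp_single (he i)
  choose t ht using fun i => hφ.exists_isGreatest_supp hω (hsingle i)
  let t' : Ω ↪o Ω := OrderEmbedding.ofMapLEIff t fun i j =>
    hle (hsingle j) (hsingle i) (ht j) (ht i)
  refine ⟨RelIso.ofSurjective t' (Finite.injective_iff_surjective.1 t'.injective),
    fun α i hα => ?_⟩
  obtain ⟨j, hj⟩ := hφ.exists_isGreatest_supp hω hα
  have hji : j = t i := le_antisymm ((hle (hsingle i) hα (ht i) hj).2 le_rfl)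
    ((hle hα (hsingle i) hj (ht i)).2 le_rfl)
  rw [hji] at hj
  exact hj

variable [∀ i, Nontrivial (H i)] {l : Ω ≃o Ω}

theorem weight_apply_eq (hφ : IsWeightIsometry F P ω φ)
    (hl : ∀ (α : ∀ i, H i) i, IsGreatest (supp α) i → IsGreatest (supp (φ α)) (l i)) (i : Ω) :
    ω (l i) = ω i := by
  refine eq_comp_orderIso_of_sum_le_eq l (fun i => ?_) i
  obtain ⟨x, hx⟩ := exists_ne (0 : H i)
  have hi := isGreatest_supp_single (P := P) hx
  rw [← wt_eq_sum_le (hl _ i hi), hφ, wt_eq_sum_le hi]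

theorem mem_suppIdeal_apply_iff (hφ : IsWeightIsometry F P ω φ) (hω : ∀ i, 0 < ω i)
    (hl : ∀ (α : ∀ i, H i) i, IsGreatest (supp α) i → IsGreatest (supp (φ α)) (l i))
    (α : ∀ i, H i) (i : Ω) : l i ∈ suppIdeal P (φ α) ↔ i ∈ suppIdeal P α := by
  let I := (suppIdeal P α).map l.toEquiv.toEmbedding
  have hmem : ∀ i, l i ∈ I ↔ i ∈ suppIdeal P α := fun i =>
    Finset.mem_map' l.toEquiv.toEmbedding
  have hI : IsIdeal P (I : Set Ω) := by
    intro b hb a hab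
    obtain ⟨b, rfl⟩ := l.surjective b
    obtain ⟨a, rfl⟩ := l.surjective a
    exact (hmem a).2 (mem_suppIdeal_of_le (l.le_iff_le.1 hab) ((hmem b).1 hb))
  have hsub : suppIdeal P (φ α) ⊆ I := by
    refine (suppIdeal_subset_iff hI).2 fun b hb => ?_
    rw [← Finset.univ_sum_single α, map_sum, Finset.sum_apply] at hb
    obtain ⟨i, -, hi⟩ := Finset.exists_ne_zero_of_sum_ne_zero hb
    have hαi : α i ≠ 0 := by
      rintro h
      rw [h, Pi.single_zero, map_zero] at hi
      exact hi rfl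
    exact hI (l i) ((hmem i).2 (mem_suppIdeal_self hαi)) b
      ((hl _ i (isGreatest_supp_single hαi)).2 hi)
  have hsum : ∑ i ∈ I, ω i ≤ ∑ i ∈ suppIdeal P (φ α), ω i := by
    rw [← wt_eq_sum_suppIdeal, hφ, Finset.sum_map]
    exact (Finset.sum_congr rfl fun i _ => hφ.weight_apply_eq hl i).le
  rw [eq_of_subset_of_sum_le hω hsub hsum, hmem]

end IsWeightIsometry

/-- The subspace of the vectors supported in the principal ideal of `i`. -/
def principalSubspace (F : Type*) [Field F] {H : Ω → Type*} [∀ i, AddCommGroup (H i)]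
    [∀ i, Module F (H i)] (P : PartialOrder Ω) (i : Ω) : Submodule F (∀ i, H i) :=
  ⨅ j ∈ {j | P.le j i}ᶜ, LinearMap.ker (LinearMap.proj j)

theorem mem_principalSubspace {i : Ω} {α : ∀ i, H i} :
    α ∈ principalSubspace F P i ↔ ∀ j ∈ suppIdeal P α, j ≤ i := by
  have hmem : α ∈ principalSubspace F P i ↔ ∀ j, α j ≠ 0 → j ≤ i := by
    simp only [principalSubspace, Submodule.mem_iInf, Set.mem_compl_iff, Set.mem_ofPred_eq,
      LinearMap.mem_ker, LinearMap.proj_apply, ne_eq, not_imp_comm]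
  rw [hmem]
  refine ⟨fun h j hj => ?_, fun h j hj => h j (mem_suppIdeal_self hj)⟩
  obtain ⟨b, hb, hjb⟩ := mem_suppIdeal.1 hj
  exact hjb.trans (h b hb)

theorem finrank_principalSubspace [∀ i, FiniteDimensional F (H i)] (i : Ω) :
    Module.finrank F (principalSubspace (H := H) F P i) =
      ∑ j with j ≤ i, Module.finrank F (H j) := by
  rw [principalSubspace, (LinearMap.iInfKerProjEquiv F H (disjoint_compl_right (a := {j | j ≤ i}))
    (Set.union_compl_self _).ge).finrank_eq, Module.finrank_pi_fintype]
  exact (Finset.sum_subtype ({j | j ≤ i} : Finset Ω) (p := (· ≤ i))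
    (fun j => Finset.mem_filter_univ j) (fun j => Module.finrank F (H j))).symm

theorem finrank_apply_eq [∀ i, FiniteDimensional F (H i)] {l : Ω ≃o Ω}
    (hl : ∀ (α : ∀ i, H i) i, l i ∈ suppIdeal P (φ α) ↔ i ∈ suppIdeal P α) (i : Ω) :
    Module.finrank F (H (l i)) = Module.finrank F (H i) := by
  refine eq_comp_orderIso_of_sum_le_eq (f := fun i => Module.finrank F (H i)) l (fun i => ?_) i
  have hmap : principalSubspace F P (l i) = (principalSubspace F P i).map φ.toLinearMap := by
    ext α
    obtain ⟨α, rfl⟩ := φ.surjective α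
    rw [Submodule.mem_map_equiv, φ.symm_apply_apply, mem_principalSubspace, mem_principalSubspace,
      ← l.toEquiv.forall_congr_right]
    exact forall_congr' fun j => imp_congr (hl α j) l.le_iff_le
  rw [← finrank_principalSubspace, ← finrank_principalSubspace, hmap, LinearEquiv.finrank_map_eq]

end InducedAutomorphism

section ConditionD

variable {Ω : Type*} [Fintype Ω] {P : PartialOrder Ω} {ω : Ω → ℝ}

/-- The elements of length less than that of `u`, together with `u`: an ideal whose only element
of length `len P u` is `u`. -/
noncomputable def lowerWith (P : PartialOrder Ω) (u : Ω) : Finset Ω :=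
  insert u ({j | len P j < len P u} : Finset Ω)

theorem mem_lowerWith {u j : Ω} : j ∈ lowerWith P u ↔ j = u ∨ len P j < len P u := by
  rw [lowerWith, Finset.mem_insert, Finset.mem_filter_univ]

theorem isIdeal_lowerWith (P : PartialOrder Ω) (u : Ω) : IsIdeal P (lowerWith P u : Set Ω) := by
  intro b hb a hab
  rw [Finset.mem_coe, mem_lowerWith] at hb ⊢
  obtain rfl | hlt := hab.eq_or_lt
  · exact hb
  · have hlen := len_strictMono hlt
    exact Or.inr (hb.elim (fun h => h ▸ hlen) hlen.trans)

theorem sum_lowerWith_eq {u v : Ω} (h : len P u = len P v) (h' : ω u = ω v) :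
    ∑ i ∈ lowerWith P u, ω i = ∑ i ∈ lowerWith P v, ω i := by
  simp [lowerWith, h, h']

theorem orderIso_apply_eq_of_lowerWith {u v : Ω} (h : len P u = len P v) {l : Ω ≃o Ω}
    (hl : (lowerWith P v : Set Ω) = l '' lowerWith P u) : l u = v := by
  have hlu := ((coe_eq_image_iff l.toEquiv).1 hl u).2 (mem_lowerWith.2 (Or.inl rfl))
  have hlen : len P (l u) = len P v := (len_orderIso_apply l u).trans h
  exact (mem_lowerWith.1 hlu).resolve_right hlen.not_lt

theorem UDP.exists_apply_eq (hU : UDP P ω) {u v : Ω} (h : len P u = len P v) (h' : ω u = ω v) :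
    ∃ l : Ω ≃o Ω, l u = v := by
  obtain ⟨l, hl, -⟩ := hU _ _ (isIdeal_lowerWith P u) (isIdeal_lowerWith P v)
    (sum_lowerWith_eq h h')
  exact ⟨l, orderIso_apply_eq_of_lowerWith h hl⟩

theorem conditionD_of_transitive {F : Type*} [Field F] {H : Ω → Type*} [∀ i, AddCommGroup (H i)]
    [∀ i, Module F (H i)] [∀ i, FiniteDimensional F (H i)] [∀ i, Nontrivial (H i)]
    (hω : ∀ i, 0 < ω i) (h : IsometriesTransitive F H P ω) : ConditionD F H P ω := by
  have key : ∀ I J : Finset Ω, IsIdeal P (I : Set Ω) → IsIdeal P (J : Set Ω) →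
      ∑ i ∈ I, ω i = ∑ j ∈ J, ω j → ∃ l : Ω ≃o Ω, (J : Set Ω) = l '' I ∧
        (∀ i, ω (l i) = ω i) ∧ ∀ i, Module.finrank F (H (l i)) = Module.finrank F (H i) := by
    intro I J hI hJ hIJ
    obtain ⟨γ, -, hγ⟩ := exists_suppIdeal_eq (H := H) hI
    obtain ⟨θ, -, hθ⟩ := exists_suppIdeal_eq (H := H) hJ
    obtain ⟨ψ, hψ, hψγ⟩ := h γ θ (by rw [wt_eq_sum_suppIdeal, wt_eq_sum_suppIdeal, hγ, hθ, hIJ])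
    obtain ⟨l, hl⟩ := hψ.exists_orderIso hω
    have hmem := hψ.mem_suppIdeal_apply_iff hω hl
    refine ⟨l, (coe_eq_image_iff l.toEquiv).2 fun i => ?_, hψ.weight_apply_eq hl,
      finrank_apply_eq hmem⟩
    rw [← hγ, ← hθ, ← hψγ]
    exact hmem γ i
  refine ⟨fun I J hI hJ hIJ => ?_, fun u v huv hω' => ?_⟩
  · obtain ⟨l, hl, hlω, -⟩ := key I J hI hJ hIJ
    exact ⟨l, hl, hlω⟩
  · obtain ⟨l, hl, -, hdim⟩ := key _ _ (isIdeal_lowerWith P u) (isIdeal_lowerWith P v)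
      (sum_lowerWith_eq huv hω')
    have huv' := hdim u
    rw [orderIso_apply_eq_of_lowerWith huv hl] at huv'
    exact ⟨LinearEquiv.ofFinrankEq _ _ huv'.symm⟩

end ConditionD

section DualPoset

variable {Ω : Type*} [Fintype Ω] {P : PartialOrder Ω} {ω : Ω → ℝ}

theorem isIdeal_compl_dualPoset {I : Finset Ω} (hI : IsIdeal P (I : Set Ω)) :
    IsIdeal (dualPoset P) ((Iᶜ : Finset Ω) : Set Ω) := by
  intro b hb a hab
  rw [Finset.mem_coe, Finset.mem_compl] at hb ⊢
  exact fun ha => hb (hI a ha b hab)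

theorem sum_compl_eq_sub (ω : Ω → ℝ) (I : Finset Ω) :
    ∑ i ∈ Iᶜ, ω i = ∑ i, ω i - ∑ i ∈ I, ω i :=
  eq_sub_of_add_eq' (Finset.sum_add_sum_compl I ω)

theorem UDP.dual {Ω : Type*} [Finite Ω] {P : PartialOrder Ω} {ω : Ω → ℝ} (h : UDP P ω) :
    UDP (dualPoset P) ω := by
  have := Fintype.ofFinite Ω
  intro I J hI hJ hIJ
  obtain ⟨l, hl, hlω⟩ := h Iᶜ Jᶜ (isIdeal_compl_dualPoset hI) (isIdeal_compl_dualPoset hJ)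
    (by rw [sum_compl_eq_sub, sum_compl_eq_sub, hIJ])
  refine ⟨l.swap, ?_, hlω⟩
  rw [Finset.coe_compl, Finset.coe_compl, Set.image_compl_eq l.bijective] at hl
  exact compl_injective hl

theorem ConditionD.dual {F : Type*} [Ring F] {H : Ω → Type*} [∀ i, AddCommGroup (H i)]
    [∀ i, Module F (H i)] (h : ConditionD F H P ω) : ConditionD F H (dualPoset P) ω := by
  refine ⟨h.1.dual, fun u v hlen hweight => h.2 u v ?_ hweight⟩
  obtain ⟨l, rfl⟩ := h.1.dual.exists_apply_eq hlen hweight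
  exact (len_orderIso_apply (P := P) (RelIso.swap l) u).symm

variable {H : Ω → Type*} [∀ i, AddCommGroup (H i)] [∀ i, Nontrivial (H i)]

theorem exists_wt_dualPoset_eq (P : PartialOrder Ω) (ω : Ω → ℝ) (β : ∀ i, H i) :
    ∃ γ : ∀ i, H i, wt (dualPoset P) ω γ = ∑ i, ω i - wt P ω β := by
  obtain ⟨γ, -, hγ⟩ := exists_suppIdeal_eq (H := H)
    (isIdeal_compl_dualPoset (isIdeal_suppIdeal P β))
  exact ⟨γ, by rw [wt_eq_sum_suppIdeal, wt_eq_sum_suppIdeal, hγ, sum_compl_eq_sub]⟩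

theorem range_wt_dualPoset :
    Set.range (wt (H := H) (dualPoset P) ω) =
      (fun x => ∑ i, ω i - x) '' Set.range (wt (H := H) P ω) := by
  refine Set.Subset.antisymm ?_ ?_
  · rintro _ ⟨β, rfl⟩
    obtain ⟨γ, hγ⟩ := exists_wt_dualPoset_eq (dualPoset P) ω β
    exact ⟨_, ⟨γ, rfl⟩, (congrArg (∑ i, ω i - ·) hγ).trans (sub_sub_cancel _ _)⟩
  · rintro _ ⟨_, ⟨β, rfl⟩, rfl⟩
    exact exists_wt_dualPoset_eq P ω β

theorem card_quotient_weightPartition_dualPoset :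
    Nat.card (Quotient (weightPartition H (dualPoset P) ω)) =
      Nat.card (Quotient (weightPartition H P ω)) := by
  rw [weightPartition, weightPartition, Nat.card_congr (Setoid.quotientKerEquivRange _),
    Nat.card_congr (Setoid.quotientKerEquivRange _), range_wt_dualPoset]
  exact Set.ncard_image_of_injective _ sub_right_injective

end DualPoset

theorem setoid_eq_of_le_of_card_le {X : Type*} [Finite X] {Γ Δ : Setoid X} (h : Γ ≤ Δ)
    (hcard : Nat.card (Quotient Γ) ≤ Nat.card (Quotient Δ)) : Γ = Δ := by
  have hsurj : Function.Surjective (Quotient.map' (s₁ := Γ) (s₂ := Δ) id fun _ _ hxy => h hxy) :=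
    fun q => q.inductionOn fun x => ⟨Quotient.mk Γ x, rfl⟩
  refine le_antisymm h fun x y hxy => Quotient.exact ?_
  exact (hsurj.bijective_of_nat_card_le hcard).1 (Quotient.sound hxy)

section Fourier

variable {Ω : Type*} [Fintype Ω] {F : Type*} [Field F] {k : Ω → ℕ}

/-- The standard inner product as a bilinear form. -/
def ipForm : LinearMap.BilinForm F (Amb F k) :=
  LinearMap.mk₂ F ip
    (fun α β γ => by simp only [ip, Pi.add_apply, add_mul, Finset.sum_add_distrib])
    (fun c α β => by simp only [ip, Pi.smul_apply, smul_eq_mul, mul_assoc, Finset.mul_sum])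
    (fun α β γ => by simp only [ip, Pi.add_apply, mul_add, Finset.sum_add_distrib])
    (fun c α β => by
      simp only [ip, Pi.smul_apply, smul_eq_mul, mul_left_comm _ c, Finset.mul_sum])

theorem ip_comm (α β : Amb F k) : ip α β = ip β α := by
  simp only [ip, mul_comm]

theorem ip_add_right (α β γ : Amb F k) : ip α (β + γ) = ip α β + ip α γ :=
  (ipForm α).map_add β γ

theorem ip_smul_left (c : F) (α β : Amb F k) : ip (c • α) β = c * ip α β :=
  (ipForm.flip β).map_smul c α

theorem ip_single (i : Ω) (t : Fin (k i)) (β : Amb F k) :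
    ip (Pi.single i (Pi.single t 1)) β = β i t := by
  rw [ip, Finset.sum_eq_single_of_mem i (Finset.mem_univ i) fun j _ hj => by
    simp [Pi.single_eq_of_ne hj]]
  simp [Pi.single_apply]

theorem flip_ipForm_eq_zero {β : Amb F k} : ipForm.flip β = 0 ↔ β = 0 := by
  refine ⟨fun h => ?_, fun h => h ▸ map_zero _⟩
  funext i t
  exact (ip_single i t β).symm.trans (LinearMap.congr_fun h _)

theorem nondegenerate_ipForm : (ipForm : LinearMap.BilinForm F (Amb F k)).Nondegenerate :=
  (LinearMap.IsSymm.isRefl ⟨ip_comm⟩).nondegenerate_iff_separatingRight.2 fun _ hβ =>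
    flip_ipForm_eq_zero.1 (LinearMap.ext hβ)

theorem mem_dualCode_iff {C : Submodule F (Amb F k)} {β : Amb F k} :
    β ∈ dualCode C ↔ (ipForm.flip β).domRestrict C = 0 :=
  ⟨fun h => LinearMap.ext fun α => h α α.2, fun h α hα => LinearMap.congr_fun h ⟨α, hα⟩⟩

section Character

variable {χ : AddChar F ℂ}

theorem sum_char_apply {V : Type*} [AddCommGroup V] [Module F V] [Fintype V] (hχ : χ ≠ 1)
    (f : V →ₗ[F] F) : ∑ x, χ (f x) = if f = 0 then (Fintype.card V : ℂ) else 0 := by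
  have htriv : χ.compAddMonoidHom f.toAddMonoidHom = 0 ↔ f = 0 := by
    refine ⟨fun h => by_contra fun hf => hχ ?_, fun h => ?_⟩
    · ext c
      obtain ⟨x, rfl⟩ := LinearMap.surjective hf c
      exact DFunLike.congr_fun h x
    · ext x
      simp [h]
  exact (AddChar.sum_eq_ite _).trans (if_congr htriv rfl rfl)

theorem sum_char_submodule [Fintype F] (hχ : χ ≠ 1) (C : Submodule F (Amb F k)) (β : Amb F k) :
    ∑ α with α ∈ C, χ (ip α β) =
      if β ∈ dualCode C then ((Finset.univ.filter (· ∈ C)).card : ℂ) else 0 := by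
  rw [← Finset.sum_subtype_eq_sum_filter, Finset.subtype_univ]
  have h := sum_char_apply hχ ((ipForm.flip β).domRestrict C)
  rw [Fintype.card_subtype] at h
  simp only [mem_dualCode_iff, ← h]
  rfl

end Character

variable [Fintype F] (χ : AddChar F ℂ)

/-- The Fourier transform of a function on the ambient space. -/
noncomputable def fourier : (Amb F k → ℂ) →ₗ[ℂ] Amb F k → ℂ :=
  (Matrix.of fun α β => χ (ip α β)).mulVecLin

theorem fourier_apply (g : Amb F k → ℂ) (α : Amb F k) :
    fourier χ g α = ∑ β, χ (ip α β) * g β := rfl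

theorem charSum_eq_fourier (B : Set (Amb F k)) (α : Amb F k) :
    charSum χ B α = fourier χ (B.indicator 1) α := by
  rw [charSum, fourier_apply, Finset.sum_filter]
  exact Finset.sum_congr rfl fun β _ => by simp [Set.indicator_apply]

variable {χ}

theorem fourier_fourier (hχ : χ ≠ 1) (g : Amb F k → ℂ) (α : Amb F k) :
    fourier χ (fourier χ g) α = Fintype.card (Amb F k) * g (-α) := by
  have hker : ∀ δ, ∑ β, χ (ip α β) * χ (ip β δ) =
      if δ = -α then (Fintype.card (Amb F k) : ℂ) else 0 := by
    intro δ
    have h := sum_char_apply hχ (ipForm.flip (α + δ))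
    simp only [flip_ipForm_eq_zero, add_eq_zero_iff_neg_eq, eq_comm (a := -α)] at h
    rw [← h]
    refine Finset.sum_congr rfl fun β _ => ?_
    rw [ip_comm α β, ← AddChar.map_add_eq_mul, ← ip_add_right]
    rfl
  simp only [fourier_apply, Finset.mul_sum, ← mul_assoc]
  rw [Finset.sum_comm]
  simp only [← Finset.sum_mul, hker, ite_mul, zero_mul, Finset.sum_ite_eq', Finset.mem_univ,
    if_true]

theorem fourier_injective (hχ : χ ≠ 1) : Function.Injective (fourier (k := k) χ) := by
  refine (injective_iff_map_eq_zero _).2 fun g hg => funext fun α => ?_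
  have h := fourier_fourier hχ g (-α)
  rw [hg, map_zero, neg_neg] at h
  exact (mul_eq_zero.1 h.symm).resolve_left (Nat.cast_ne_zero.2 Fintype.card_ne_zero)

theorem sum_mul_eq_sum_mul_of_classes {X R : Type*} [Fintype X] [NonUnitalNonAssocSemiring R]
    {Γ : Setoid X} {g w w' : X → R} (hg : ∀ x y, Γ x y → g x = g y)
    (h : ∀ B ∈ Γ.classes, ∑ x with x ∈ B, w x = ∑ x with x ∈ B, w' x) :
    ∑ x, w x * g x = ∑ x, w' x * g x := by
  have hfib : ∀ w : X → R, ∑ x, w x * g x =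
      ∑ q : Quotient Γ, (∑ x with x ∈ {y | Γ y q.out}, w x) * g q.out := by
    intro w
    rw [← Finset.sum_fiberwise (g := Quotient.mk Γ)]
    refine Finset.sum_congr rfl fun q _ => ?_
    rw [Finset.sum_mul]
    refine Finset.sum_congr (Finset.filter_congr fun x _ => Quotient.mk_eq_iff_out)
      fun x hx => ?_
    rw [hg _ _ (Finset.mem_filter.1 hx).2]
  rw [hfib, hfib]
  exact Finset.sum_congr rfl fun q _ => by rw [h _ ⟨q.out, rfl⟩]

theorem fourier_eq_of_dualPartition {Γ : Setoid (Amb F k)} {α γ : Amb F k}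
    (h : dualPartition χ Γ α γ) {g : Amb F k → ℂ} (hg : ∀ x y, Γ x y → g x = g y) :
    fourier χ g α = fourier χ g γ :=
  sum_mul_eq_sum_mul_of_classes hg h

/-- The Fourier transform of functions constant on the classes of a partition, as a map to the
functions on the classes of the dual partition. -/
noncomputable def fourierQuotient (χ : AddChar F ℂ) (Γ : Setoid (Amb F k)) :
    (Quotient Γ → ℂ) →ₗ[ℂ] Quotient (dualPartition χ Γ) → ℂ :=
  LinearMap.funLeft ℂ ℂ Quotient.out ∘ₗ fourier χ ∘ₗ LinearMap.funLeft ℂ ℂ (Quotient.mk Γ)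

theorem fourierQuotient_mk (Γ : Setoid (Amb F k)) (g : Quotient Γ → ℂ) (α : Amb F k) :
    fourierQuotient χ Γ g (Quotient.mk _ α) = fourier χ (g ∘ Quotient.mk Γ) α :=
  fourier_eq_of_dualPartition (Quotient.mk_out (s := dualPartition χ Γ) α)
    fun _ _ hxy => congrArg g (Quotient.sound hxy)

theorem fourierQuotient_injective (hχ : χ ≠ 1) (Γ : Setoid (Amb F k)) :
    Function.Injective (fourierQuotient χ Γ) := fun g h hgh =>
  Quotient.mk_surjective.injective_comp_right <| fourier_injective hχ <| funext fun α => by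
    rw [← fourierQuotient_mk, ← fourierQuotient_mk, hgh]

theorem card_quotient_le_dualPartition (hχ : χ ≠ 1) (Γ : Setoid (Amb F k)) :
    Nat.card (Quotient Γ) ≤ Nat.card (Quotient (dualPartition χ Γ)) := by
  have h := LinearMap.finrank_le_finrank_of_injective (fourierQuotient_injective hχ Γ)
  simpa only [Module.finrank_fintype_fun_eq_card, ← Nat.card_eq_fintype_card] using h

theorem fourierQuotient_surjective (hχ : χ ≠ 1) {Γ : Setoid (Amb F k)}
    (hcard : Nat.card (Quotient (dualPartition χ Γ)) = Nat.card (Quotient Γ)) :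
    Function.Surjective (fourierQuotient χ Γ) := by
  refine (LinearMap.injective_iff_surjective_of_finrank_eq_finrank ?_).1
    (fourierQuotient_injective hχ Γ)
  simp only [Module.finrank_fintype_fun_eq_card, ← Nat.card_eq_fintype_card, hcard]

theorem fourierReflexive_of_card_eq (hχ : χ ≠ 1) {Γ : Setoid (Amb F k)}
    (hneg : ∀ x y, Γ x y → Γ (-x) (-y))
    (hcard : Nat.card (Quotient (dualPartition χ Γ)) = Nat.card (Quotient Γ)) :
    FourierReflexive χ Γ := by
  refine (setoid_eq_of_le_of_card_le ?_ (hcard ▸ card_quotient_le_dualPartition hχ _)).symm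
  rintro x y hxy _ ⟨z, rfl⟩
  obtain ⟨g, hg⟩ := fourierQuotient_surjective hχ hcard (Pi.single (Quotient.mk _ z) 1)
  have hfourier : fourier χ (g ∘ Quotient.mk Γ) = Set.indicator {x | dualPartition χ Γ x z} 1 := by
    funext β
    rw [← fourierQuotient_mk, hg, Pi.single_apply, Set.indicator_apply]
    exact if_congr Quotient.eq rfl rfl
  rw [charSum_eq_fourier, charSum_eq_fourier, ← hfourier, fourier_fourier hχ, fourier_fourier hχ,
    Function.comp_apply, Function.comp_apply, Quotient.sound (hneg x y hxy)]

theorem card_eq_of_fourierReflexive (hχ : χ ≠ 1) {Γ : Setoid (Amb F k)}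
    (h : FourierReflexive χ Γ) :
    Nat.card (Quotient (dualPartition χ Γ)) = Nat.card (Quotient Γ) := by
  refine le_antisymm ?_ (card_quotient_le_dualPartition hχ Γ)
  have hle := card_quotient_le_dualPartition hχ (dualPartition χ Γ)
  rwa [show dualPartition χ (dualPartition χ Γ) = Γ from h] at hle

/-- The Poisson summation formula. -/
theorem sum_charSum_submodule (hχ : χ ≠ 1) (C : Submodule F (Amb F k)) (B : Set (Amb F k)) :
    ∑ α with α ∈ C, charSum χ B α =
      (Finset.univ.filter (· ∈ C)).card * ((dualCode C ∩ B).ncard : ℂ) := by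
  have hcount : (dualCode C ∩ B).ncard =
      (Finset.univ.filter fun β => β ∈ B ∧ β ∈ dualCode C).card := by
    rw [← Set.ncard_coe_finset, Finset.coe_filter_univ, Set.inter_comm]
    rfl
  simp only [charSum]
  rw [Finset.sum_comm]
  simp only [sum_char_submodule hχ]
  rw [← Finset.sum_filter, Finset.sum_const, Finset.filter_filter, nsmul_eq_mul, mul_comm, hcount]

theorem sum_eq_of_sameDistribution {X R : Type*} [Fintype X] [NonAssocSemiring R] {Γ : Setoid X}
    {D₁ D₂ : Set X} (h : SameDistribution Γ D₁ D₂) {g : X → R} (hg : ∀ x y, Γ x y → g x = g y) :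
    ∑ x with x ∈ D₁, g x = ∑ x with x ∈ D₂, g x := by
  have hclass : ∀ D B : Set X, ∑ x with x ∈ B, (if x ∈ D then (1 : R) else 0) =
      (D ∩ B).ncard := by
    intro D B
    rw [Finset.sum_boole, Finset.filter_filter, ← Set.ncard_coe_finset, Finset.coe_filter_univ,
      Set.inter_comm]
    rfl
  have hsum := sum_mul_eq_sum_mul_of_classes hg (w := fun x => if x ∈ D₁ then 1 else 0)
    (w' := fun x => if x ∈ D₂ then 1 else 0) fun B hB => by rw [hclass, hclass, h B hB]
  simpa only [Finset.sum_filter, ite_mul, one_mul, zero_mul] using hsum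

theorem sameDistribution_dualCode (hχ : χ ≠ 1) {Γ Δ : Setoid (Amb F k)}
    (h : Δ ≤ dualPartition χ Γ) {C₁ C₂ : Submodule F (Amb F k)}
    (hC : SameDistribution Δ (C₁ : Set (Amb F k)) (C₂ : Set (Amb F k))) :
    SameDistribution Γ (dualCode C₁) (dualCode C₂) := by
  intro B hB
  have hsum := sum_eq_of_sameDistribution hC (g := charSum χ B) fun x y hxy => h hxy B hB
  have hcard := sum_eq_of_sameDistribution hC (g := fun _ => (1 : ℂ)) fun _ _ _ => rfl
  simp only [Finset.sum_const, nsmul_eq_mul, mul_one, SetLike.mem_coe] at hsum hcard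
  rw [sum_charSum_submodule hχ, sum_charSum_submodule hχ, hcard] at hsum
  have hne : ((Finset.univ.filter (· ∈ C₂)).card : ℂ) ≠ 0 :=
    Nat.cast_ne_zero.2 (Finset.card_ne_zero_of_mem ((Finset.mem_filter_univ 0).2 C₂.zero_mem))
  exact_mod_cast mul_left_cancel₀ hne hsum

end Fourier

section SpanSingleton

variable {F V : Type*} [DivisionRing F] [AddCommGroup V] [Module F V] {α : V}

theorem ncard_span_singleton_inter (hα : α ≠ 0) (B : Set V) :
    ((Submodule.span F {α} : Set V) ∩ B).ncard = {c : F | c • α ∈ B}.ncard := by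
  rw [← Set.ncard_image_of_injective _ (smul_left_injective F hα),
    ← LinearMap.range_toSpanSingleton, LinearMap.coe_range, Set.inter_comm]
  exact congrArg Set.ncard Set.image_preimage_eq_inter_range.symm

theorem sum_span_singleton [Fintype F] [Fintype V] {M : Type*} [AddCommMonoid M] (hα : α ≠ 0)
    (f : V → M) : ∑ x with x ∈ Submodule.span F {α}, f x = ∑ c : F, f (c • α) := by
  rw [← Finset.sum_image fun c _ d _ hcd => smul_left_injective F hα hcd]
  refine Finset.sum_congr (Finset.ext fun x => ?_) fun _ _ => rfl
  rw [Finset.mem_filter_univ, mem_image_univ_iff_mem_range]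
  exact Submodule.mem_span_singleton

end SpanSingleton

section MacWilliams

variable {Ω : Type*} [Fintype Ω] {F : Type*} [Field F] {k : Ω → ℕ}
  {P : PartialOrder Ω} {ω : Ω → ℝ}

theorem sameDistribution_span_singleton {α γ : Amb F k} (hα : α ≠ 0) (hγ : γ ≠ 0)
    (h : wt P ω α = wt P ω γ) :
    SameDistribution (weightPartition (fun i => Fin (k i) → F) P ω)
      (Submodule.span F {α} : Set (Amb F k)) (Submodule.span F {γ} : Set (Amb F k)) := by
  rintro _ ⟨y, rfl⟩
  have hwt : ∀ c : F, wt P ω (c • α) = wt P ω (c • γ) := by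
    intro c
    obtain rfl | hc := eq_or_ne c 0
    · rw [zero_smul, zero_smul]
    · rw [wt_smul P ω hc, wt_smul P ω hc, h]
  rw [ncard_span_singleton_inter hα, ncard_span_singleton_inter hγ]
  refine congrArg Set.ncard (Set.ext fun c => ?_)
  change wt P ω (c • α) = wt P ω y ↔ wt P ω (c • γ) = wt P ω y
  rw [hwt]

section CharSum

variable [Fintype F] {χ : AddChar F ℂ}

theorem charSum_apply_eq_of_adjoint (χ : AddChar F ℂ) {B : Set (Amb F k)} {α γ : Amb F k}
    (T : Equiv.Perm (Amb F k)) (hB : ∀ β, T β ∈ B ↔ β ∈ B) (hT : ∀ β, ip γ β = ip α (T β)) :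
    charSum χ B γ = charSum χ B α :=
  Finset.sum_equiv T (fun β => by rw [Finset.mem_filter_univ, Finset.mem_filter_univ, hB])
    fun β _ => congrArg χ (hT β)

theorem charSum_smul (χ : AddChar F ℂ) {B : Set (Amb F k)} {c : F} (hc : c ≠ 0)
    (hB : ∀ β, c • β ∈ B ↔ β ∈ B) (α : Amb F k) : charSum χ B (c • α) = charSum χ B α :=
  charSum_apply_eq_of_adjoint χ (LinearEquiv.smulOfNeZero F (Amb F k) c hc).toEquiv hB
    fun β => by rw [ip_smul_left]; exact ((ipForm α).map_smul c β).symm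

theorem charSum_zero_add_charSum (hχ : χ ≠ 1) {B : Set (Amb F k)}
    (hB : ∀ c : F, c ≠ 0 → ∀ β, c • β ∈ B ↔ β ∈ B) {α : Amb F k} (hα : α ≠ 0) :
    charSum χ B 0 + (Fintype.card F - 1 : ℂ) * charSum χ B α =
      Fintype.card F * ((dualCode (Submodule.span F {α}) ∩ B).ncard : ℂ) := by
  have hpoisson := sum_charSum_submodule hχ (Submodule.span F {α}) B
  have hcard : (Finset.univ.filter (· ∈ Submodule.span F {α})).card = Fintype.card F := by
    rw [Finset.card_eq_sum_ones, sum_span_singleton hα, ← Finset.card_eq_sum_ones,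
      Finset.card_univ]
  rw [hcard, sum_span_singleton hα, ← Finset.add_sum_erase _ _ (Finset.mem_univ (0 : F)),
    zero_smul] at hpoisson
  rw [← hpoisson, Finset.sum_congr rfl fun c hc =>
      charSum_smul χ (Finset.ne_of_mem_erase hc) (hB c (Finset.ne_of_mem_erase hc)) α,
    Finset.sum_const, Finset.card_erase_of_mem (Finset.mem_univ _), Finset.card_univ,
    nsmul_eq_mul, Nat.cast_sub Fintype.card_pos, Nat.cast_one]

/-- Two vectors of equal weight span lines with equal weight distributions, and Poisson summation
over a line recovers the character sum. -/
theorem le_dualPartition_of_macWilliams (hω : ∀ i, 0 < ω i) (hχ : χ ≠ 1)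
    (h : AdmitsMacWilliamsIdentity F k P ω) :
    weightPartition (fun i => Fin (k i) → F) (dualPoset P) ω ≤
      dualPartition χ (weightPartition (fun i => Fin (k i) → F) P ω) := by
  intro α γ (hαγ : wt (dualPoset P) ω α = wt (dualPoset P) ω γ) B hB
  have hzero : α = 0 ↔ γ = 0 := by
    rw [← wt_eq_zero (P := dualPoset P) hω, hαγ, wt_eq_zero hω]
  obtain rfl | hα := eq_or_ne α 0
  · rw [hzero.1 rfl]
  have hγ : γ ≠ 0 := mt hzero.2 hα
  have hdual := h _ _ (sameDistribution_span_singleton hα hγ hαγ) B hB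
  have hsmul : ∀ c : F, c ≠ 0 → ∀ β, c • β ∈ B ↔ β ∈ B := by
    obtain ⟨y, rfl⟩ := hB
    intro c hc β
    change wt P ω (c • β) = wt P ω y ↔ wt P ω β = wt P ω y
    rw [wt_smul P ω hc]
  have hline := charSum_zero_add_charSum hχ hsmul hα
  rw [hdual, ← charSum_zero_add_charSum hχ hsmul hγ] at hline
  have hq : (Fintype.card F - 1 : ℂ) ≠ 0 :=
    sub_ne_zero.2 (Nat.cast_ne_one.2 Fintype.one_lt_card.ne')
  exact mul_left_cancel₀ hq (add_left_cancel hline)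

end CharSum

theorem mem_suppIdeal_of_adjoint {ψ : Amb F k →ₗ[F] Amb F k} {l : Ω ≃o Ω}
    (hl : ∀ α i, l i ∈ suppIdeal (dualPoset P) (ψ α) ↔ i ∈ suppIdeal (dualPoset P) α)
    {β β' : Amb F k} (hβ : ∀ α, ip (ψ α) β = ip α β') {i : Ω} (hi : i ∈ suppIdeal P β') :
    l i ∈ suppIdeal P β := by
  obtain ⟨j, hj, hij⟩ := mem_suppIdeal.1 hi
  obtain ⟨t, ht⟩ := Function.ne_iff.1 hj
  rw [← ip_single j t β', ← hβ] at ht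
  obtain ⟨b, -, hb⟩ := Finset.exists_ne_zero_of_sum_ne_zero ht
  obtain ⟨s, -, hs⟩ := Finset.exists_ne_zero_of_sum_ne_zero hb
  obtain ⟨b, rfl⟩ := l.surjective b
  have hψb : ψ (Pi.single j (Pi.single t 1)) (l b) ≠ 0 := fun h0 =>
    left_ne_zero_of_mul hs (congrFun h0 s)
  have hjb : j ≤ b := (mem_suppIdeal_iff_le (P := dualPoset P)
    (isGreatest_supp_single (P := dualPoset P) (Pi.single_ne_zero_iff.2 one_ne_zero))).1
    ((hl _ b).1 (mem_suppIdeal_self hψb))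
  exact mem_suppIdeal.2 ⟨l b, fun h0 => right_ne_zero_of_mul hs (congrFun h0 s),
    l.monotone (hij.trans hjb)⟩

/-- The adjoint does not increase weights, and an injective self-map of a finite set that does not
increase weights preserves them. -/
theorem IsWeightIsometry.exists_adjoint [Finite F] [∀ i, NeZero (k i)] (hω : ∀ i, 0 < ω i)
    {ψ : Amb F k ≃ₗ[F] Amb F k} (hψ : IsWeightIsometry F (dualPoset P) ω ψ) :
    ∃ T : Equiv.Perm (Amb F k), (∀ β, wt P ω (T β) = wt P ω β) ∧
      ∀ α β, ip (ψ α) β = ip α (T β) := by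
  have := Fintype.ofFinite F
  obtain ⟨l, hl⟩ := hψ.exists_orderIso hω
  let T := ipForm.leftAdjointOfNondegenerate nondegenerate_ipForm ψ.toLinearMap
  have hadj : ∀ α β, ip (ψ α) β = ip α (T β) := by
    intro α β
    rw [ip_comm, ip_comm α]
    exact (ipForm.isAdjointPairLeftAdjointOfNondegenerate nondegenerate_ipForm _ β α).symm
  have hinj : Function.Injective T := (injective_iff_map_eq_zero T).2 fun β hβ =>
    flip_ipForm_eq_zero.1 <| LinearMap.ext fun α => by
      obtain ⟨α, rfl⟩ := ψ.surjective α
      exact (hadj α β).trans (hβ ▸ (ipForm α).map_zero)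
  have hle : ∀ β, wt P ω (T β) ≤ wt P ω β := by
    intro β
    have hsub : (suppIdeal P (T β)).map l.toEquiv.toEmbedding ⊆ suppIdeal P β :=
      fun _ hx => by
        obtain ⟨i, hi, rfl⟩ := Finset.mem_map.1 hx
        exact mem_suppIdeal_of_adjoint (P := P) (l := RelIso.swap l)
          (hψ.mem_suppIdeal_apply_iff hω hl) (hadj · β) hi
    have hsum := sum_le_sum_of_subset_of_pos hω hsub
    rw [Finset.sum_map] at hsum
    rw [wt_eq_sum_suppIdeal, wt_eq_sum_suppIdeal]
    exact (Finset.sum_congr rfl fun i _ => (hψ.weight_apply_eq hl i).symm).trans_le hsum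
  let T' := Equiv.ofBijective T (Finite.injective_iff_bijective.1 hinj)
  refine ⟨T', fun β => ?_, hadj⟩
  exact (Finset.sum_eq_sum_iff_of_le fun β (_ : β ∈ Finset.univ) => hle β).1
    (Equiv.sum_comp T' (wt P ω)) β (Finset.mem_univ β)

variable [Fintype F] {χ : AddChar F ℂ} [∀ i, NeZero (k i)]

theorem le_dualPartition_of_conditionD (χ : AddChar F ℂ) (hω : ∀ i, 0 < ω i)
    (h : ConditionD F (fun i => Fin (k i) → F) P ω) :
    weightPartition (fun i => Fin (k i) → F) (dualPoset P) ω ≤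
      dualPartition χ (weightPartition (fun i => Fin (k i) → F) P ω) := by
  rintro α γ hαγ _ ⟨y, rfl⟩
  obtain ⟨ψ, hψ, rfl⟩ := transitive_of_conditionD hω h.dual α γ hαγ
  obtain ⟨T, hT, hadj⟩ := hψ.exists_adjoint hω
  refine (charSum_apply_eq_of_adjoint χ T (fun β => ?_) (hadj α)).symm
  change wt P ω (T β) = wt P ω y ↔ wt P ω β = wt P ω y
  rw [hT]

theorem eq_dualPartition_of_le (hχ : χ ≠ 1)
    (h : weightPartition (fun i => Fin (k i) → F) (dualPoset P) ω ≤
      dualPartition χ (weightPartition (fun i => Fin (k i) → F) P ω)) :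
    weightPartition (fun i => Fin (k i) → F) (dualPoset P) ω =
      dualPartition χ (weightPartition (fun i => Fin (k i) → F) P ω) :=
  setoid_eq_of_le_of_card_le h <|
    card_quotient_weightPartition_dualPoset.trans_le (card_quotient_le_dualPartition hχ _)

theorem eq_dualPartition_iff_macWilliams (hω : ∀ i, 0 < ω i) (hχ : χ ≠ 1) :
    weightPartition (fun i => Fin (k i) → F) (dualPoset P) ω =
      dualPartition χ (weightPartition (fun i => Fin (k i) → F) P ω) ↔
    AdmitsMacWilliamsIdentity F k P ω :=
  ⟨fun h _ _ hC => sameDistribution_dualCode hχ h.le hC, fun h =>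
    eq_dualPartition_of_le hχ (le_dualPartition_of_macWilliams hω hχ h)⟩

theorem fourierReflexive_of_eq_dualPartition (hχ : χ ≠ 1)
    (h : weightPartition (fun i => Fin (k i) → F) (dualPoset P) ω =
      dualPartition χ (weightPartition (fun i => Fin (k i) → F) P ω)) :
    FourierReflexive χ (weightPartition (fun i => Fin (k i) → F) P ω) :=
  fourierReflexive_of_card_eq hχ
    (fun α β hαβ => (wt_neg P ω α).trans (hαβ.trans (wt_neg P ω β).symm))
    (h ▸ card_quotient_weightPartition_dualPoset)

theorem eq_dualPartition_of_fourierReflexive (hχ : χ ≠ 1)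
    (h : FourierReflexive χ (weightPartition (fun i => Fin (k i) → F) P ω))
    (hle : dualPartition χ (weightPartition (fun i => Fin (k i) → F) P ω) ≤
      weightPartition (fun i => Fin (k i) → F) (dualPoset P) ω) :
    weightPartition (fun i => Fin (k i) → F) (dualPoset P) ω =
      dualPartition χ (weightPartition (fun i => Fin (k i) → F) P ω) :=
  (setoid_eq_of_le_of_card_le hle <|
    ((card_eq_of_fourierReflexive hχ h).trans card_quotient_weightPartition_dualPoset.symm).le).symm

end MacWilliams

section ExponentialProducts

open Complex

/-- The entire function `s ↦ 1 + a exp (x s)`, an elementary factor of a generating function in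
which `exp (x s)` marks weight `x`. -/
noncomputable def expFactor (a x : ℝ) (s : ℂ) : ℂ := 1 + a * exp (x * s)

theorem differentiable_expFactor (a x : ℝ) : Differentiable ℂ (expFactor a x) := by
  unfold expFactor
  fun_prop

theorem expFactor_ne_zero (a : ℝ) {x : ℝ} (hx : x ≠ 0) : expFactor a x ≠ 0 := by
  intro h
  have h₀ : (1 + a : ℂ) = 0 := by simpa [expFactor] using congrFun h 0
  have h₁ : (1 + a * 2 : ℂ) = 0 := by
    have hexp : exp (x * (Real.log 2 / x : ℝ)) = 2 := by
      rw [← ofReal_mul, mul_div_cancel₀ _ hx, ← ofReal_exp, Real.exp_log two_pos, ofReal_ofNat]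
    rw [← hexp]
    exact congrFun h (Real.log 2 / x : ℝ)
  norm_cast at h₀ h₁
  linarith

/-- The zero is `s = (π i - log c) / n`: it makes `exp (n s)` equal to `-1 / c`, while `exp (m s)`
is not real for `0 < m < n`. -/
theorem exists_expFactor_eq_zero_iff {c n : ℝ} (hc : 0 < c) (hn : 0 < n) :
    ∃ s : ℂ, ∀ a ≠ 0, ∀ m, 0 < m → m ≤ n → (expFactor a m s = 0 ↔ m = n ∧ a = c) := by
  refine ⟨(-Real.log c / n : ℝ) + (Real.pi / n : ℝ) * I, fun a ha m hm hmn => ?_⟩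
  rw [expFactor, mul_add, exp_add, ← mul_assoc (m : ℂ) _ I, ← ofReal_mul, ← ofReal_mul,
    ← ofReal_exp]
  obtain rfl | hlt := hmn.eq_or_lt
  · rw [mul_div_cancel₀ _ hn.ne', mul_div_cancel₀ _ hn.ne', exp_pi_mul_I, Real.exp_neg,
      Real.exp_log hc, mul_neg_one, mul_neg, ← sub_eq_add_neg, sub_eq_zero]
    norm_cast
    rw [← div_eq_mul_inv, eq_div_iff hc.ne', one_mul, eq_comm, eq_self_iff_true, true_and]
  · refine iff_of_false (fun h => ?_) fun h => hlt.ne h.1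
    have him := congrArg im h
    rw [add_im, one_im, zero_add, im_ofReal_mul, im_ofReal_mul, exp_ofReal_mul_I_im, zero_im] at him
    refine mul_ne_zero ha (mul_ne_zero (Real.exp_pos _).ne' ?_) him
    refine (Real.sin_pos_of_pos_of_lt_pi (by positivity) ?_).ne'
    rw [← mul_div_assoc, div_lt_iff₀ hn, mul_comm]
    exact mul_lt_mul_of_pos_left hlt Real.pi_pos

theorem eq_of_mul_eq_mul_of_differentiable {f g h : ℂ → ℂ} (hf : Differentiable ℂ f)
    (hg : Differentiable ℂ g) (hh : Differentiable ℂ h) (hf₀ : f ≠ 0) (hfgh : f * g = f * h) :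
    g = h := by
  have hcases := AnalyticOnNhd.eq_zero_or_eq_zero_of_mul_eq_zero (U := Set.univ)
    (fun z _ => hf.analyticAt z) (fun z _ => (hg.sub hh).analyticAt z)
    (fun z _ => by
      rw [Pi.sub_apply, mul_sub, sub_eq_zero]
      exact congrFun hfgh z) isPreconnected_univ
  refine hcases.elim (fun h₀ => absurd (funext fun z => h₀ z trivial) hf₀) fun h₀ => ?_
  exact funext fun z => sub_eq_zero.1 (h₀ z trivial)

variable {ι : Type*}

/-- The product over `A` of the factors `1 + a i * exp (n i * s)`. -/
noncomputable def expProd (a n : ι → ℝ) (A : Finset ι) : ℂ → ℂ := ∏ i ∈ A, expFactor (a i) (n i)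

theorem differentiable_expProd (a n : ι → ℝ) (A : Finset ι) : Differentiable ℂ (expProd a n A) :=
  Differentiable.finsetProd fun i _ => differentiable_expFactor (a i) (n i)

theorem expProd_apply_eq_zero_iff {a n : ι → ℝ} {A : Finset ι} {s : ℂ} :
    expProd a n A s = 0 ↔ ∃ i ∈ A, expFactor (a i) (n i) s = 0 := by
  rw [expProd, Finset.prod_apply, Finset.prod_eq_zero_iff]

theorem expProd_ne_zero (a : ι → ℝ) {n : ι → ℝ} (hn : ∀ i, n i ≠ 0) (A : Finset ι) :
    expProd a n A ≠ 0 := by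
  induction A using Finset.induction_on with
  | empty => exact one_ne_zero
  | insert i A hi ih =>
    intro h
    rw [expProd, Finset.prod_insert hi, ← expProd] at h
    exact ih (eq_of_mul_eq_mul_of_differentiable (differentiable_expFactor _ _)
      (differentiable_expProd a n A) (differentiable_const 0) (expFactor_ne_zero _ (hn i))
      (h.trans (mul_zero _).symm))

variable {n c : ι → ℝ} {A B : Finset ι}

/-- Comparing the zeros of both sides at a zero of `1 + c exp (n s)` with `n` maximal. -/
theorem exists_match_of_expProd_eq (hn : ∀ i, 0 < n i) (hc : ∀ i, 0 < c i)
    (h : expProd (-1) n A * expProd c n B = expProd (-1) n B * expProd c n A) {i : ι} (hi : i ∈ A)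
    (hA : ∀ j ∈ A, n j ≤ n i) (hB : ∀ j ∈ B, n j ≤ n i) :
    ∃ j ∈ B, n j = n i ∧ c j = c i := by
  obtain ⟨s, hs⟩ := exists_expFactor_eq_zero_iff (hc i) (hn i)
  have hzero : expProd c n A s = 0 :=
    expProd_apply_eq_zero_iff.2 ⟨i, hi, (hs _ (hc i).ne' _ (hn i) le_rfl).2 ⟨rfl, rfl⟩⟩
  have hprod := congrFun h s
  rw [Pi.mul_apply, Pi.mul_apply, hzero, mul_zero, mul_eq_zero, expProd_apply_eq_zero_iff,
    expProd_apply_eq_zero_iff] at hprod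
  obtain ⟨j, hj, hjs⟩ | ⟨j, hj, hjs⟩ := hprod
  · have hneg : (-1 : ℝ) = c i :=
      ((hs _ (neg_ne_zero.2 one_ne_zero) _ (hn j) (hA j hj)).1 hjs).2
    linarith [hc i]
  · exact ⟨j, hj, (hs _ (hc j).ne' _ (hn j) (hB j hj)).1 hjs⟩

theorem expProd_erase_eq (hn : ∀ i, n i ≠ 0)
    (h : expProd (-1) n A * expProd c n B = expProd (-1) n B * expProd c n A) {i j : ι}
    (hi : i ∈ A) (hj : j ∈ B) (hnij : n j = n i) (hcij : c j = c i) :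
    expProd (-1) n (A.erase i) * expProd c n (B.erase j) =
      expProd (-1) n (B.erase j) * expProd c n (A.erase i) := by
  have herase : ∀ (a : ι → ℝ) {S : Finset ι} {x : ι}, x ∈ S →
      expProd a n S = expFactor (a x) (n x) * expProd a n (S.erase x) :=
    fun a _ _ hx => (Finset.mul_prod_erase _ _ hx).symm
  have hdiff := differentiable_expProd (ι := ι)
  rw [herase (-1) hi, herase c hi, herase (-1) hj, herase c hj, hnij, hcij] at h
  refine eq_of_mul_eq_mul_of_differentiable (differentiable_expFactor (c i) (n i))
    ((hdiff _ _ _).mul (hdiff _ _ _)) ((hdiff _ _ _).mul (hdiff _ _ _))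
    (expFactor_ne_zero _ (hn i)) ?_
  refine eq_of_mul_eq_mul_of_differentiable (differentiable_expFactor (-1) (n i))
    (.mul (differentiable_expFactor _ _) ((hdiff _ _ _).mul (hdiff _ _ _)))
    (.mul (differentiable_expFactor _ _) ((hdiff _ _ _).mul (hdiff _ _ _)))
    (expFactor_ne_zero _ (hn i)) ?_
  simp only [Pi.neg_apply, Pi.one_apply] at h
  linear_combination h

theorem map_eq_map_of_expProd_eq {L : Type*} (d : ι → L) (hn : ∀ i, 0 < n i) (hc : ∀ i, 0 < c i)
    (hd : ∀ i ∈ A, ∀ j ∈ B, n j = n i → c j = c i → d i = d j)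
    (h : expProd (-1) n A * expProd c n B = expProd (-1) n B * expProd c n A) :
    A.val.map d = B.val.map d := by
  refine map_eq_map_of_cancel d d (fun S T => S ⊆ A ∧ T ⊆ B ∧
    expProd (-1) n S * expProd c n T = expProd (-1) n T * expProd c n S) ?_
    ⟨subset_rfl, subset_rfl, h⟩
  rintro S T ⟨hS, hT, hST⟩ hne
  obtain ⟨i, hi, hmax⟩ := (S ∪ T).exists_max_image n (Finset.union_nonempty.2 hne)
  have hmaxS : ∀ j ∈ S, n j ≤ n i := fun j hj => hmax j (Finset.mem_union_left _ hj)
  have hmaxT : ∀ j ∈ T, n j ≤ n i := fun j hj => hmax j (Finset.mem_union_right _ hj)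
  obtain ⟨i, hi, j, hj, hnij, hcij⟩ : ∃ i ∈ S, ∃ j ∈ T, n j = n i ∧ c j = c i := by
    obtain hi | hi := Finset.mem_union.1 hi
    · exact ⟨i, hi, exists_match_of_expProd_eq hn hc hST hi hmaxS hmaxT⟩
    · obtain ⟨j, hj, hnij, hcij⟩ := exists_match_of_expProd_eq hn hc hST.symm hi hmaxT hmaxS
      exact ⟨j, hj, i, hi, hnij.symm, hcij.symm⟩
  exact ⟨i, hi, j, hj, hd i (hS hi) j (hT hj) hnij hcij, (S.erase_subset i).trans hS,
    (T.erase_subset j).trans hT, expProd_erase_eq (fun i => (hn i).ne') hST hi hj hnij hcij⟩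

/-- A generating function in which each block of `W` contributes `1 - exp (n s)` or
`1 + c exp (n s)` remembers, up to labels, which blocks contribute the former. -/
theorem map_eq_map_of_prod_ite_eq {L : Type*} (d : ι → L) (hn : ∀ i, 0 < n i) (hc : ∀ i, 0 < c i)
    {W : Finset ι} (hA : A ⊆ W) (hB : B ⊆ W)
    (hd : ∀ i ∈ A, ∀ j ∈ B, n j = n i → c j = c i → d i = d j)
    (h : ∏ i ∈ W, expFactor (if i ∈ A then -1 else c i) (n i) =
      ∏ i ∈ W, expFactor (if i ∈ B then -1 else c i) (n i)) :
    A.val.map d = B.val.map d := by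
  have hW : ∀ S ⊆ W, (∏ i ∈ W, expFactor (if i ∈ S then -1 else c i) (n i)) * expProd c n S =
      expProd c n W * expProd (-1) n S := by
    intro S hS
    rw [expProd, expProd, expProd, ← Finset.prod_sdiff hS, ← Finset.prod_sdiff hS, mul_assoc,
      mul_assoc, mul_comm (∏ i ∈ S, expFactor (c i) (n i))]
    congr 1
    · exact Finset.prod_congr rfl fun i hi => by rw [if_neg (Finset.mem_sdiff.1 hi).2]
    · exact congrArg (· * _) (Finset.prod_congr rfl fun i hi => by rw [if_pos hi]; rfl)
  have hdiff := differentiable_expProd (ι := ι)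
  refine map_eq_map_of_expProd_eq d hn hc hd (eq_of_mul_eq_mul_of_differentiable (hdiff c n W)
    ((hdiff _ _ _).mul (hdiff _ _ _)) ((hdiff _ _ _).mul (hdiff _ _ _))
    (expProd_ne_zero c (fun i => (hn i).ne') W) ?_)
  rw [← mul_assoc, ← mul_assoc, ← hW A hA, ← hW B hB, h, mul_right_comm]

end ExponentialProducts

section LevelEnumerator

open Complex

variable {Ω : Type*} [Fintype Ω] {P : PartialOrder Ω} {ω : Ω → ℝ}

theorem IsHierarchical.mem_suppIdeal_iff {H : Ω → Type*} [∀ i, AddCommGroup (H i)]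
    (hP : IsHierarchical P) {β : ∀ i, H i} {i : Ω} :
    i ∈ suppIdeal P β ↔ β i ≠ 0 ∨ ∃ b, β b ≠ 0 ∧ len P i < len P b := by
  simp only [mem_suppIdeal, hP.le_iff, and_or_left, exists_or]
  exact or_congr_left ⟨fun ⟨_, hb, hib⟩ => hib ▸ hb, fun hi => ⟨i, hi, rfl⟩⟩

section Weight

variable {H : Ω → Type*} [∀ i, AddCommGroup (H i)] {β : ∀ i, H i} {r : ℕ}

theorem wt_le_sum_levels_iff (hω : ∀ i, 0 < ω i) (hP : IsHierarchical P) :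
    wt P ω β ≤ ∑ i with len P i ≤ r, ω i ↔ ∀ i, β i ≠ 0 → len P i ≤ r := by
  constructor
  · intro h b hb
    by_contra! hrb
    have hsub : ({i | len P i ≤ r} : Finset Ω) ⊆ suppIdeal P β := fun i hi =>
      hP.mem_suppIdeal_iff.2 (Or.inr ⟨b, hb, ((Finset.mem_filter_univ i).1 hi).trans_lt hrb⟩)
    have hbr := mem_suppIdeal_self (P := P) hb
    rw [← eq_of_subset_of_sum_le hω hsub h, Finset.mem_filter_univ] at hbr
    exact hbr.not_gt hrb
  · refine fun hβ => sum_le_sum_of_subset_of_pos hω fun i hi => ?_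
    obtain ⟨b, hb, hib⟩ := mem_suppIdeal.1 hi
    exact (Finset.mem_filter_univ i).2 ((len_strictMono.monotone hib).trans (hβ b hb))

theorem sum_top_level_eq (hω : ∀ i, 0 < ω i) (hP : IsHierarchical P)
    (hβ : ∀ i, β i ≠ 0 → len P i ≤ r) :
    ∑ i with β i ≠ 0 ∧ len P i = r, ω i = max (wt P ω β - ∑ i with len P i < r, ω i) 0 := by
  by_cases htop : ∃ b, β b ≠ 0 ∧ len P b = r
  · have hideal : suppIdeal P β =
        ({i | len P i < r} : Finset Ω).disjUnion {i | β i ≠ 0 ∧ len P i = r}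
          (Finset.disjoint_filter.2 fun i _ hlt heq => hlt.ne heq.2) := by
      obtain ⟨b, hb, rfl⟩ := htop
      ext i
      rw [hP.mem_suppIdeal_iff, Finset.mem_disjUnion, Finset.mem_filter_univ,
        Finset.mem_filter_univ]
      constructor
      · rintro (hi | ⟨c, hc, hic⟩)
        · exact (hβ i hi).lt_or_eq.imp_right fun h => ⟨hi, h⟩
        · exact Or.inl (hic.trans_le (hβ c hc))
      · rintro (hi | hi)
        · exact Or.inr ⟨b, hb, hi⟩
        · exact Or.inl hi.1
    rw [wt_eq_sum_suppIdeal, hideal, Finset.sum_disjUnion, add_sub_cancel_left, max_eq_left]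
    exact Finset.sum_nonneg fun i _ => (hω i).le
  · push Not at htop
    rw [Finset.filter_false_of_mem fun i _ hi => htop i hi.1 hi.2, Finset.sum_empty, max_eq_right]
    refine sub_nonpos.2 (sum_le_sum_of_subset_of_pos hω fun i hi => ?_)
    obtain ⟨b, hb, hib⟩ := mem_suppIdeal.1 hi
    exact (Finset.mem_filter_univ i).2
      ((len_strictMono.monotone hib).trans_lt (lt_of_le_of_ne (hβ b hb) (htop b hb)))

/-- The monomial by which a nonzero block `i` contributes to `levelEnum`. -/
noncomputable def levelMark (P : PartialOrder Ω) (ω : Ω → ℝ) (r : ℕ) (s : ℂ) (i : Ω) : ℂ :=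
  if len P i < r then 1 else if len P i = r then exp (ω i * s) else 0

/-- The term of a weight enumerator at level `r`: nonzero blocks at level `r` mark their weight
by an exponential, those below are ignored, and those above are forbidden. It is multiplicative over
the blocks, and yet, for a hierarchical poset, determined by the weight. -/
noncomputable def levelEnum (P : PartialOrder Ω) (ω : Ω → ℝ) (r : ℕ) (s : ℂ) (β : ∀ i, H i) : ℂ :=
  ∏ i, if β i = 0 then 1 else levelMark P ω r s i

theorem levelEnum_eq (hω : ∀ i, 0 < ω i) (hP : IsHierarchical P) (s : ℂ) :
    levelEnum P ω r s β = if wt P ω β ≤ ∑ i with len P i ≤ r, ω i then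
      exp ((max (wt P ω β - ∑ i with len P i < r, ω i) 0 : ℝ) * s) else 0 := by
  by_cases hβ : ∀ i, β i ≠ 0 → len P i ≤ r
  · rw [if_pos ((wt_le_sum_levels_iff hω hP).2 hβ), ← sum_top_level_eq hω hP hβ, ofReal_sum,
      Finset.sum_mul, exp_sum, Finset.prod_filter, levelEnum]
    refine Finset.prod_congr rfl fun i _ => ?_
    by_cases hi : β i = 0
    · simp only [hi, if_true, ne_eq, not_true_eq_false, false_and, if_false]
    · obtain hlt | heq := (hβ i hi).lt_or_eq
      · simp only [levelMark, hi, hlt, hlt.ne, if_false, if_true, and_false]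
      · simp only [levelMark, hi, heq, lt_irrefl, if_false, if_true, ne_eq, not_false_eq_true,
          and_self]
  · rw [if_neg (mt (wt_le_sum_levels_iff hω hP).1 hβ)]
    push Not at hβ
    obtain ⟨b, hb, hrb⟩ := hβ
    refine Finset.prod_eq_zero (Finset.mem_univ b) ?_
    rw [if_neg hb, levelMark, if_neg hrb.not_gt, if_neg hrb.ne']

end Weight

variable {F : Type*} [Field F] [Fintype F] {k : Ω → ℕ} {χ : AddChar F ℂ}

theorem fourier_prod (χ : AddChar F ℂ) (g : ∀ i, (Fin (k i) → F) → ℂ) (α : Amb F k) :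
    fourier χ (fun β => ∏ i, g i (β i)) α = ∏ i, ∑ x, χ (α i ⬝ᵥ x) * g i x := by
  rw [Finset.prod_univ_sum, Fintype.piFinset_univ, fourier_apply]
  refine Finset.sum_congr rfl fun β _ => ?_
  rw [Finset.prod_mul_distrib]
  congr 1
  exact map_prod χ.toMonoidHom (fun i => Multiplicative.ofAdd (α i ⬝ᵥ β i)) Finset.univ

theorem sum_char_mul_ite {n : ℕ} (hχ : χ ≠ 1) (a : Fin n → F) (y : ℂ) :
    ∑ x, χ (a ⬝ᵥ x) * (if x = 0 then 1 else y) =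
      1 + ((if a = 0 then (Fintype.card F : ℂ) ^ n else 0) - 1) * y := by
  have hchar : ∑ x, χ (a ⬝ᵥ x) = if a = 0 then (Fintype.card F : ℂ) ^ n else 0 := by
    have h := sum_char_apply hχ (dotProductBilin F F a)
    rw [Fintype.card_pi_const, Nat.cast_pow] at h
    have hzero : dotProductBilin F F a = 0 ↔ a = 0 :=
      LinearMap.ext_iff.trans dotProduct_eq_zero_iff
    simp only [hzero] at h
    exact h
  have hsplit : ∀ x, χ (a ⬝ᵥ x) * (if x = 0 then 1 else y) =
      χ (a ⬝ᵥ x) * y + if x = 0 then 1 - y else 0 := by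
    intro x
    split_ifs with hx
    · rw [hx, dotProduct_zero, AddChar.map_zero_eq_one]
      ring
    · rw [add_zero]
  rw [Finset.sum_congr rfl fun x _ => hsplit x, Finset.sum_add_distrib, ← Finset.sum_mul, hchar,
    Finset.sum_ite_eq', if_pos (Finset.mem_univ _)]
  ring

theorem fourier_levelEnum (hχ : χ ≠ 1) (r : ℕ) (s : ℂ) {α : Amb F k}
    (hα : ∀ i, len P i < r → α i = 0) :
    fourier χ (levelEnum P ω r s) α =
      (∏ i with len P i < r, (Fintype.card F : ℂ) ^ k i) *
      ∏ i with len P i = r,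
        expFactor (if α i ≠ 0 then -1 else (Fintype.card F : ℝ) ^ k i - 1) (ω i) s := by
  have hlevel : levelEnum P ω r s =
      fun β : Amb F k => ∏ i, if β i = 0 then 1 else levelMark P ω r s i :=
    funext fun β => Finset.prod_congr rfl fun i _ => by congr
  rw [hlevel, fourier_prod χ (fun i x => if x = 0 then 1 else levelMark P ω r s i),
    Finset.prod_filter, Finset.prod_filter, ← Finset.prod_mul_distrib]
  refine Finset.prod_congr rfl fun i _ => ?_
  rw [sum_char_mul_ite hχ, levelMark, expFactor]
  obtain hlt | heq | hgt := lt_trichotomy (len P i) r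
  · rw [if_pos (hα i hlt), if_pos hlt, if_pos hlt, if_neg hlt.ne]
    ring
  · rw [if_neg heq.not_lt, if_pos heq, if_neg heq.not_lt, if_pos heq, one_mul]
    by_cases hi : α i = 0
    · simp only [hi, if_true, ne_eq, not_true_eq_false, if_false]
      push_cast
      ring
    · simp only [hi, if_true, ne_eq, not_false_eq_true, if_false]
      push_cast
      ring
  · rw [if_neg hgt.not_gt, if_neg hgt.ne', if_neg hgt.not_gt, if_neg hgt.ne', mul_zero, add_zero,
      one_mul]

end LevelEnumerator

section HierarchicalDuality

variable {Ω : Type*} [Fintype Ω] {F : Type*} [Field F] [Fintype F] {k : Ω → ℕ}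
  {P : PartialOrder Ω} {ω : Ω → ℝ} {χ : AddChar F ℂ} {α γ : Amb F k}

theorem exists_perm_level_of_dualPartition [∀ i, NeZero (k i)] (hχ : χ ≠ 1) (hω : ∀ i, 0 < ω i)
    (hP : IsHierarchical P)
    (h : dualPartition χ (weightPartition (fun i => Fin (k i) → F) P ω) α γ) {r : ℕ}
    (hα : ∀ i, len P i < r → α i = 0) (hγ : ∀ i, len P i < r → γ i = 0) :
    ∃ σ : Equiv.Perm Ω, (∀ i, len P (σ i) = len P i) ∧ (∀ i, ω (σ i) = ω i) ∧
      (∀ i, k (σ i) = k i) ∧ ∀ i, len P i = r → (γ (σ i) ≠ 0 ↔ α i ≠ 0) := by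
  have hq : 1 < Fintype.card F := Fintype.one_lt_card
  have hprod : ∏ i with len P i = r,
        expFactor (if α i ≠ 0 then -1 else (Fintype.card F : ℝ) ^ k i - 1) (ω i) =
      ∏ i with len P i = r,
        expFactor (if γ i ≠ 0 then -1 else (Fintype.card F : ℝ) ^ k i - 1) (ω i) := by
    funext s
    have hs := fourier_eq_of_dualPartition h (g := levelEnum P ω r s) fun x y hxy => by
      rw [levelEnum_eq hω hP, levelEnum_eq hω hP, show wt P ω x = wt P ω y from hxy]
    rw [fourier_levelEnum hχ r s hα, fourier_levelEnum hχ r s hγ] at hs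
    rw [Finset.prod_apply, Finset.prod_apply]
    exact mul_left_cancel₀ (Finset.prod_ne_zero_iff.2 fun i _ =>
      pow_ne_zero _ (Nat.cast_ne_zero.2 Fintype.card_ne_zero)) hs
  have hlabels := map_eq_map_of_prod_ite_eq (fun i => (len P i, ω i, k i)) hω
    (c := fun i => (Fintype.card F : ℝ) ^ k i - 1)
    (fun i => sub_pos.2 (one_lt_pow₀ (Nat.one_lt_cast.2 hq) (NeZero.ne _)))
    (W := {i | len P i = r}) (A := {i | len P i = r ∧ α i ≠ 0}) (B := {i | len P i = r ∧ γ i ≠ 0})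
    (Finset.monotone_filter_right _ fun _ _ hi => hi.1)
    (Finset.monotone_filter_right _ fun _ _ hi => hi.1) ?_ ?_
  · obtain ⟨σ, hσ, hmem⟩ := exists_perm_of_map_eq hlabels
    simp only [Prod.mk.injEq, Finset.mem_filter_univ] at hσ hmem
    refine ⟨σ, fun i => (hσ i).1, fun i => (hσ i).2.1, fun i => (hσ i).2.2, fun i hi => ?_⟩
    have hiff := hmem i
    rwa [(hσ i).1, hi, eq_self_iff_true, true_and, true_and] at hiff
  · intro i hi j hj hω' hk
    rw [Finset.mem_filter_univ] at hi hj
    have hkij : k j = k i := Nat.pow_right_injective hq (by exact_mod_cast sub_left_injective hk)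
    rw [hi.1, hj.1, hω', hkij]
  · convert hprod using 3 with i hi i hi <;>
      simp only [Finset.mem_filter_univ, (Finset.mem_filter_univ _).1 hi, true_and]

theorem eq_zero_below_of_dualPartition [∀ i, NeZero (k i)] (hχ : χ ≠ 1) (hω : ∀ i, 0 < ω i)
    (hP : IsHierarchical P)
    (h : dualPartition χ (weightPartition (fun i => Fin (k i) → F) P ω) α γ) {r : ℕ}
    (hα : ∀ i, len P i < r → α i = 0) : ∀ i, len P i < r → γ i = 0 := by
  induction r with
  | zero => exact fun i hi => absurd hi (Nat.not_lt_zero _)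
  | succ r ih =>
    have hα' : ∀ i, len P i < r → α i = 0 := fun i hi => hα i (hi.trans r.lt_succ_self)
    obtain ⟨σ, hlen, -, -, hne⟩ := exists_perm_level_of_dualPartition hχ hω hP h hα' (ih hα')
    intro i hi
    obtain hlt | heq := Nat.lt_succ_iff_lt_or_eq.1 hi
    · exact ih hα' i hlt
    · obtain ⟨i, rfl⟩ := σ.surjective i
      rw [hlen] at hi heq
      by_contra hγi
      exact (hne i heq).1 hγi (hα i hi)

theorem IsHierarchical.mem_suppIdeal_dualPoset_iff {H : Ω → Type*} [∀ i, AddCommGroup (H i)]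
    (hP : IsHierarchical P) {β : ∀ i, H i} {b : Ω} (hb : β b ≠ 0)
    (hβ : ∀ i, len P i < len P b → β i = 0) {i : Ω} :
    i ∈ suppIdeal (dualPoset P) β ↔ (len P i = len P b ∧ β i ≠ 0) ∨ len P b < len P i := by
  refine (mem_suppIdeal (P := dualPoset P)).trans ⟨?_, ?_⟩
  · rintro ⟨c, hc, hci⟩
    have hbc : len P b ≤ len P c := not_lt.1 fun hlt => hc (hβ c hlt)
    obtain rfl | hlt := hP.le_iff.1 hci
    · exact hbc.eq_or_lt.imp_left fun heq => ⟨heq.symm, hc⟩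
    · exact Or.inr (hbc.trans_lt hlt)
  · rintro (hi | hi)
    · exact ⟨i, hi.2, P.le_refl i⟩
    · exact ⟨b, hb, hP.le_iff.2 (Or.inr hi)⟩

theorem exists_perm_of_dualPartition [∀ i, NeZero (k i)] (hχ : χ ≠ 1) (hω : ∀ i, 0 < ω i)
    (hP : IsHierarchical P)
    (h : dualPartition χ (weightPartition (fun i => Fin (k i) → F) P ω) α γ) :
    ∃ σ : Equiv.Perm Ω, (∀ i, len P (σ i) = len P i) ∧ (∀ i, ω (σ i) = ω i) ∧
      (∀ i, k (σ i) = k i) ∧ ∀ i, σ i ∈ suppIdeal (dualPoset P) γ ↔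
        i ∈ suppIdeal (dualPoset P) α := by
  obtain rfl | hα₀ := eq_or_ne α 0
  · obtain rfl : γ = 0 := funext fun i =>
      eq_zero_below_of_dualPartition hχ hω hP h (fun _ _ => rfl) i (len P i).lt_succ_self
    exact ⟨Equiv.refl _, fun _ => rfl, fun _ => rfl, fun _ => rfl, fun _ => Iff.rfl⟩
  · obtain ⟨b, hb, hmin⟩ : ∃ b, α b ≠ 0 ∧ ∀ i, α i ≠ 0 → len P b ≤ len P i := by
      obtain ⟨b, hb, hmin⟩ := Set.exists_min_image {i | α i ≠ 0} (len P) (Set.toFinite _)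
        (Function.ne_iff.1 hα₀)
      exact ⟨b, hb, hmin⟩
    have hα : ∀ i, len P i < len P b → α i = 0 := fun i hi =>
      by_contra fun hne => (hmin i hne).not_gt hi
    have hγ := eq_zero_below_of_dualPartition hχ hω hP h hα
    obtain ⟨σ, hlen, hσω, hσk, hne⟩ := exists_perm_level_of_dualPartition hχ hω hP h hα hγ
    refine ⟨σ, hlen, hσω, hσk, fun i => ?_⟩
    rw [hP.mem_suppIdeal_dualPoset_iff hb hα,
      hP.mem_suppIdeal_dualPoset_iff ((hne b rfl).2 hb) (by rwa [hlen]), hlen, hlen]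
    exact or_congr_left (and_congr_right fun hi => hne i hi)

theorem dualPartition_le_of_hierarchical [∀ i, NeZero (k i)] (hχ : χ ≠ 1) (hω : ∀ i, 0 < ω i)
    (hP : IsHierarchical P) :
    dualPartition χ (weightPartition (fun i => Fin (k i) → F) P ω) ≤
      weightPartition (fun i => Fin (k i) → F) (dualPoset P) ω := by
  intro α γ h
  obtain ⟨σ, -, hσω, -, hmem⟩ := exists_perm_of_dualPartition hχ hω hP h
  exact wt_eq_of_perm (P := dualPoset P) σ hσω hmem

theorem IsHierarchical.exists_orderIso_apply_eq (hP : IsHierarchical P) {u v : Ω}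
    (hlen : len P u = len P v) (huv : ω u = ω v) :
    ∃ l : Ω ≃o Ω, l u = v ∧ ∀ i, ω (l i) = ω i :=
  ⟨hP.orderIsoOfLen (Equiv.swap u v) fun i => Equiv.apply_swap_eq_self hlen i,
    Equiv.swap_apply_left u v, fun i => Equiv.apply_swap_eq_self huv i⟩

theorem conditionD_of_hierarchical [∀ i, NeZero (k i)] (hχ : χ ≠ 1) (hω : ∀ i, 0 < ω i)
    (hP : IsHierarchical P)
    (h : weightPartition (fun i => Fin (k i) → F) (dualPoset P) ω ≤
      dualPartition χ (weightPartition (fun i => Fin (k i) → F) P ω)) :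
    ConditionD F (fun i => Fin (k i) → F) P ω := by
  refine ⟨UDP.dual (P := dualPoset P) fun I J hI hJ hIJ => ?_, fun u v hlen huv => ?_⟩
  · obtain ⟨α, -, rfl⟩ := exists_suppIdeal_eq (P := dualPoset P) (H := fun i => Fin (k i) → F) hI
    obtain ⟨γ, -, rfl⟩ := exists_suppIdeal_eq (P := dualPoset P) (H := fun i => Fin (k i) → F) hJ
    obtain ⟨σ, hlen, hσω, -, hmem⟩ :=
      exists_perm_of_dualPartition hχ hω hP (h (show wt _ ω α = wt _ ω γ from hIJ))
    exact ⟨(hP.orderIsoOfLen σ hlen).swap, (coe_eq_image_iff σ).2 hmem, hσω⟩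
  · obtain ⟨x, hx⟩ := exists_ne (0 : Fin (k u) → F)
    obtain ⟨y, hy⟩ := exists_ne (0 : Fin (k v) → F)
    have hu (i : Ω) := mem_suppIdeal_iff_le (P := dualPoset P) (j := i)
      (isGreatest_supp_single (P := dualPoset P) (H := fun i => Fin (k i) → F) hx)
    have hv (i : Ω) := mem_suppIdeal_iff_le (P := dualPoset P) (j := i)
      (isGreatest_supp_single (P := dualPoset P) (H := fun i => Fin (k i) → F) hy)
    obtain ⟨l, rfl, hlω⟩ := hP.exists_orderIso_apply_eq hlen huv
    have hwt := wt_eq_of_perm (P := dualPoset P) l.toEquiv hlω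
      fun i => (hv _).trans (l.le_iff_le.trans (hu i).symm)
    obtain ⟨σ, hσlen, -, hσk, hmem⟩ := exists_perm_of_dualPartition hχ hω hP (h hwt)
    have hle : l u ≤ σ u := (hv _).1 ((hmem u).2 ((hu u).2 (P.le_refl u)))
    have heq : l u = σ u :=
      (hP.le_iff.1 hle).resolve_right (by rw [hσlen, ← hlen]; exact lt_irrefl _)
    rw [heq]
    change Nonempty ((Fin (k u) → F) ≃ₗ[F] (Fin (k (σ u)) → F))
    rw [hσk]
    exact ⟨LinearEquiv.refl F _⟩

end HierarchicalDuality

section SubspaceFamilies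

variable {F E : Type*} [Field F] [AddCommGroup E] [Module F E]

theorem natCard_mul_natCard_le_of_lt [Finite F] [Finite E] {A B : Submodule F E} (h : A < B) :
    Nat.card F * Nat.card A ≤ Nat.card B := by
  rw [Module.natCard_eq_pow_finrank (K := F) (V := A),
    Module.natCard_eq_pow_finrank (K := F) (V := B), ← pow_succ']
  exact Nat.pow_le_pow_right Nat.card_pos (Submodule.finrank_lt_finrank_of_lt h)

theorem natCard_le_mul_natCard_inf_ker {W : Type*} [AddCommGroup W] [Module F W] [Finite W]
    (K : Submodule F E) (f : E →ₗ[F] W) :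
    Nat.card K ≤ Nat.card W * Nat.card (K ⊓ LinearMap.ker f : Submodule F E) := by
  have hker : Nat.card (LinearMap.ker (f.domRestrict K)) =
      Nat.card (K ⊓ LinearMap.ker f : Submodule F E) := by
    rw [LinearMap.ker_domRestrict]
    exact Nat.card_congr (Equiv.subtypeSubtypeEquivSubtypeInter (· ∈ K) (· ∈ LinearMap.ker f))
  rw [(LinearMap.ker (f.domRestrict K)).card_eq_card_quotient_mul_card, hker,
    Nat.card_congr (f.domRestrict K).quotKerEquivRange.toEquiv, mul_comm]
  exact Nat.mul_le_mul_right _ (Nat.card_le_card_of_injective _ Subtype.val_injective)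

variable {ι κ : Type*} {S : Finset ι} {T : Finset κ} {V : ι → Submodule F E}
  {U : κ → Submodule F E}

theorem sum_natCard_inf_eq_sum_card (K : Submodule F E) [Fintype K] (S : Finset ι)
    (V : ι → Submodule F E) :
    ∑ i ∈ S, Nat.card (K ⊓ V i : Submodule F E) = ∑ x : K, (S.filter (x.1 ∈ V ·)).card := by
  refine Eq.trans (Finset.sum_congr rfl fun i _ => ?_)
    (Finset.sum_card_bipartiteAbove_eq_sum_card_bipartiteBelow (t := Finset.univ)
      fun i (x : K) => x.1 ∈ V i)
  rw [Finset.bipartiteAbove, ← Fintype.card_subtype, ← Nat.card_eq_fintype_card]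
  exact (Nat.card_congr (Equiv.subtypeSubtypeEquivSubtypeInter (· ∈ K) (· ∈ V i))).symm

/-- Any member of the family meets any other in a subspace of index at most `|F|`. This holds for
hyperplanes of a common space, possibly together with that space itself. -/
def MeetInHyperplanes (S : Finset ι) (V : ι → Submodule F E) : Prop :=
  ∀ i ∈ S, ∀ j ∈ S, Nat.card (V i) ≤ Nat.card F * Nat.card (V i ⊓ V j : Submodule F E)

theorem MeetInHyperplanes.erase (h : MeetInHyperplanes S V) (i : ι) :
    MeetInHyperplanes (S.erase i) V :=
  fun a ha b hb => h a (Finset.mem_of_mem_erase ha) b (Finset.mem_of_mem_erase hb)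

/-- Counting pairs `(x, j)` with `x ∈ V i ⊓ U j`: were every `V i ⊓ U j` proper in `V i`, there
would be at most `|T| |V i| / |F|` of them, which is too few. -/
theorem exists_le_of_card_filter_mem_eq [Finite F] [Finite E] {i : ι}
    (hV : S.card ≤ Nat.card F ∨ MeetInHyperplanes S V)
    (h : ∀ x, (S.filter (x ∈ V ·)).card = (T.filter (x ∈ U ·)).card) (hi : i ∈ S) :
    ∃ j ∈ T, V i ≤ U j := by
  by_contra! hno
  have : Fintype (V i) := Fintype.ofFinite _
  have hST : S.card = T.card := by simpa using h 0
  have hq : 1 < Nat.card F := Finite.one_lt_card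
  have hK : 0 < Nat.card (V i) := Nat.card_pos
  have hT : Nat.card F * ∑ j ∈ T, Nat.card (V i ⊓ U j : Submodule F E) ≤
      S.card * Nat.card (V i) := by
    rw [Finset.mul_sum, hST, ← smul_eq_mul (T.card)]
    exact Finset.sum_le_card_nsmul _ _ _ fun j hj =>
      natCard_mul_natCard_le_of_lt (inf_lt_left.2 (hno j hj))
  have hS : S.card * Nat.card (V i) <
      Nat.card F * ∑ i' ∈ S, Nat.card (V i ⊓ V i' : Submodule F E) := by
    rcases hV with hV | hV
    · by_cases hne : ∃ i' ∈ S, i' ≠ i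
      · obtain ⟨i', hi', hne⟩ := hne
        have hlt := Finset.single_lt_sum hne hi hi'
          (f := fun i' => Nat.card (V i ⊓ V i' : Submodule F E)) Nat.card_pos
          fun _ _ _ => Nat.zero_le _
        rw [inf_idem] at hlt
        exact Nat.mul_lt_mul_of_le_of_lt hV hlt Nat.card_pos
      · push Not at hne
        rw [Finset.eq_singleton_iff_unique_mem.2 ⟨hi, hne⟩, Finset.card_singleton,
          Finset.sum_singleton, inf_idem, one_mul]
        exact lt_mul_of_one_lt_left hK hq
    · rw [Finset.mul_sum, ← smul_eq_mul S.card, ← Finset.sum_const]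
      refine Finset.sum_lt_sum (hV i hi) ⟨i, hi, ?_⟩
      rw [inf_idem]
      exact lt_mul_of_one_lt_left hK hq
  rw [sum_natCard_inf_eq_sum_card, Finset.sum_congr rfl fun (x : V i) _ => h x,
    ← sum_natCard_inf_eq_sum_card] at hS
  exact hS.not_ge hT

theorem map_eq_map_of_card_filter_mem_eq [Finite F] [Finite E]
    (hV : S.card ≤ Nat.card F ∨ MeetInHyperplanes S V ∧ MeetInHyperplanes T U)
    (h : ∀ x, (S.filter (x ∈ V ·)).card = (T.filter (x ∈ U ·)).card) :
    S.val.map V = T.val.map U := by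
  refine map_eq_map_of_cancel V U (fun S T =>
    (S.card ≤ Nat.card F ∨ MeetInHyperplanes S V ∧ MeetInHyperplanes T U) ∧
    ∀ x, (S.filter (x ∈ V ·)).card = (T.filter (x ∈ U ·)).card) ?_ ⟨hV, h⟩
  rintro S T ⟨hV, h⟩ hne
  have hST : S.card = T.card := by simpa using h 0
  have hVU (i) (hi : i ∈ S) : ∃ j ∈ T, V i ≤ U j :=
    exists_le_of_card_filter_mem_eq (hV.imp_right And.left) h hi
  have hUV (j) (hj : j ∈ T) : ∃ i ∈ S, U j ≤ V i :=
    exists_le_of_card_filter_mem_eq (hV.imp hST.symm.trans_le And.right) (fun x => (h x).symm) hj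
  have hSne : S.Nonempty := hne.elim id fun ⟨j, hj⟩ => let ⟨i, hi, _⟩ := hUV j hj; ⟨i, hi⟩
  obtain ⟨i, hi, hmax⟩ := S.exists_maximalFor V hSne
  obtain ⟨j, hj, hij⟩ := hVU i hi
  obtain ⟨i', hi', hji⟩ := hUV j hj
  have heq : V i = U j := hij.antisymm (hji.trans (hmax hi' (hij.trans hji)))
  refine ⟨i, hi, j, hj, heq, ?_, fun x => ?_⟩
  · exact hV.imp Finset.card_erase_le.trans fun hV => ⟨hV.1.erase i, hV.2.erase j⟩
  · rw [Finset.filter_erase, Finset.filter_erase, Finset.card_erase_eq_ite,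
      Finset.card_erase_eq_ite, h x]
    simp only [Finset.mem_filter, hi, hj, heq]

end SubspaceFamilies

section Extension

variable {Ω : Type*} [Fintype Ω] {F : Type*} [Field F] {H : Ω → Type*} [∀ i, AddCommGroup (H i)]
  [∀ i, Module F (H i)] {P : PartialOrder Ω} {ω : Ω → ℝ} {X : Type*} [AddCommGroup X] [Module F X]
  {a b : X →ₗ[F] (∀ i, H i)}

/-- The elements of `X` for which `i` lies outside the ideal generated by the support of their
image under `a`. -/
def avoiding (P : PartialOrder Ω) (a : X →ₗ[F] (∀ i, H i)) (i : Ω) : Submodule F X :=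
  LinearMap.ker (LinearMap.pi fun j : {j // P.le i j} => LinearMap.proj j.1 ∘ₗ a)

theorem mem_avoiding {i : Ω} {x : X} : x ∈ avoiding P a i ↔ i ∉ suppIdeal P (a x) := by
  rw [avoiding, LinearMap.mem_ker, funext_iff, Subtype.forall, mem_suppIdeal]
  push Not
  exact forall_congr' fun j => (not_imp_not (a := a x j = 0) (b := i ≤ j)).symm

theorem card_filter_mem_avoiding_eq (hU : UDP P ω) (hab : ∀ x, wt P ω (a x) = wt P ω (b x))
    {S : Finset Ω} (hS : ∀ l : Ω ≃o Ω, (∀ i, ω (l i) = ω i) → ∀ i, i ∈ S ↔ l i ∈ S) (x : X) :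
    (S.filter (x ∈ avoiding P a ·)).card = (S.filter (x ∈ avoiding P b ·)).card := by
  obtain ⟨l, hl, hlω⟩ : ∃ l : Ω ≃o Ω, _ ∧ _ :=
    hU (suppIdeal P (a x)) (suppIdeal P (b x)) (isIdeal_suppIdeal P _) (isIdeal_suppIdeal P _)
      (hab x)
  refine Finset.card_equiv l.toEquiv fun i => ?_
  rw [Finset.mem_filter, Finset.mem_filter, mem_avoiding, mem_avoiding]
  exact and_congr (hS l hlω i) ((coe_eq_image_iff l.toEquiv).1 hl i).not.symm

theorem IsHierarchical.avoiding_inf_avoiding (hP : IsHierarchical P) {i j : Ω}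
    (h : len P i = len P j) :
    avoiding P a i ⊓ avoiding P a j =
      avoiding P a i ⊓ LinearMap.ker (LinearMap.proj j ∘ₗ a) := by
  ext x
  simp only [Submodule.mem_inf, mem_avoiding]
  refine and_congr_right fun hi => ?_
  rw [mem_suppIdeal_iff_ne_zero, not_not]
  · rfl
  · intro c hjc
    by_contra hc
    exact hi (mem_suppIdeal.2 ⟨c, hc, hP.le_iff.2 (Or.inr (h.trans_lt (len_strictMono hjc)))⟩)

theorem IsHierarchical.meetInHyperplanes_avoiding [∀ i, Finite (H i)] (hP : IsHierarchical P)
    {S : Finset Ω} (hlen : ∀ i ∈ S, ∀ j ∈ S, len P i = len P j)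
    (hS : ∀ i ∈ S, Nat.card (H i) ≤ Nat.card F) : MeetInHyperplanes S (avoiding P a) := by
  intro i hi j hj
  rw [hP.avoiding_inf_avoiding (hlen i hi j hj)]
  exact (natCard_le_mul_natCard_inf_ker _ _).trans (Nat.mul_le_mul_right _ (hS j hj))

theorem IsHierarchical.exists_orderIso_mem_suppIdeal_iff [Finite F] [Finite X]
    [∀ i, Finite (H i)] (hP : IsHierarchical P) (hU : UDP P ω)
    (hab : ∀ x, wt P ω (a x) = wt P ω (b x))
    (hN : ∀ r c, {i | len P i = r ∧ ω i = c}.ncard ≤ Nat.card F ∨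
      ∀ i, len P i = r → ω i = c → Nat.card (H i) ≤ Nat.card F) :
    ∃ s : Ω ≃o Ω, (∀ i, ω (s i) = ω i) ∧
      ∀ x i, s i ∈ suppIdeal P (a x) ↔ i ∈ suppIdeal P (b x) := by
  obtain ⟨σ, hσ⟩ := exists_perm_of_forall_map_eq (p := fun i => (len P i, ω i))
    (c := avoiding P b) (d := avoiding P a) fun ⟨r, c⟩ => by
      simp only [Prod.mk.injEq]
      have hlevel : ∀ i ∈ Finset.univ.filter fun i => len P i = r ∧ ω i = c, len P i = r := by
        simp +contextual
      have hlen := fun i hi j hj => (hlevel i hi).trans (hlevel j hj).symm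
      refine (map_eq_map_of_card_filter_mem_eq (F := F) ((hN r c).imp (fun h => ?_) fun h => ?_)
        (card_filter_mem_avoiding_eq hU hab fun l hl i => ?_)).symm
      · rwa [← Set.ncard_coe_finset, Finset.coe_filter_univ]
      · have hS : ∀ i ∈ Finset.univ.filter fun i => len P i = r ∧ ω i = c,
            Nat.card (H i) ≤ Nat.card F := by
          simpa using h
        exact ⟨hP.meetInHyperplanes_avoiding hlen hS, hP.meetInHyperplanes_avoiding hlen hS⟩
      · simp only [Finset.mem_filter_univ, len_orderIso_apply, hl]
  simp only [Prod.mk.injEq] at hσ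
  refine ⟨hP.orderIsoOfLen σ fun i => (hσ i).1.1, fun i => (hσ i).1.2, fun x i => ?_⟩
  rw [← not_iff_not, ← mem_avoiding, ← mem_avoiding]
  exact iff_of_eq (congrArg (x ∈ ·) (hσ i).2)

theorem mep_of_conditionD [Fintype F] {k : Ω → ℕ} (hω : ∀ i, 0 < ω i) (hP : IsHierarchical P)
    (hD : ConditionD F (fun i => Fin (k i) → F) P ω) (hN : NumericCondition F k P ω) :
    MEP F (fun i => Fin (k i) → F) P ω := by
  intro C f hf
  obtain ⟨s, hsω, hs⟩ := hP.exists_orderIso_mem_suppIdeal_iff (a := C.subtype) (b := f) hD.1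
    (fun x => (hf x).symm) fun r c => by
      obtain hne | ⟨i, hir, hic⟩ := {i | len P i = r ∧ ω i = c}.eq_empty_or_nonempty
      · exact Or.inl (by simp [hne])
      · rw [Nat.card_eq_fintype_card]
        have hrc := hN r (hir ▸ one_le_len P i) (hir ▸ len_le_maxChainCard P i) c ⟨i, hir, hic⟩
        exact hrc.symm.imp_right fun h j hjr hjc => by simp [h j hjr hjc]
  exact exists_isometry_of_mem_suppIdeal_iff hω s hsω
    (fun i => (hD.2 (s i) i (len_orderIso_apply s i) (hsω i)).some) hs

end Extension

section Pencil

variable {F : Type*} [Field F]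

/-- The linear functionals on `F × F` up to scalar multiples, indexed by the projective line
`Option F` with `none` as the point at infinity. -/
def pencil : Option F → F × F →ₗ[F] F
  | none => LinearMap.fst F F F
  | some t => LinearMap.snd F F F - t • LinearMap.fst F F F

theorem exists_pencil_apply_eq_zero_iff {x : F × F} (hx : x ≠ 0) :
    ∃ o, ∀ o', pencil o' x = 0 ↔ o' = o := by
  obtain ⟨x, y⟩ := x
  obtain rfl | h0 := eq_or_ne x 0
  · have hy : y ≠ 0 := by
      rintro rfl
      exact hx rfl
    refine ⟨none, fun o' => ?_⟩
    cases o' <;> simp [pencil, hy]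
  · refine ⟨some (y / x), fun o' => ?_⟩
    cases o' with
    | none => simp [pencil, h0]
    | some t => simp [pencil, sub_eq_zero, eq_div_iff h0, eq_comm]

end Pencil

section Spread

variable {Ω : Type*} {F : Type*} [Field F] {H : Ω → Type*} [∀ i, AddCommGroup (H i)]
  [∀ i, Module F (H i)] {ι V X : Type*} [AddCommGroup V] [Module F V] [AddCommGroup X] [Module F X]
  {e : ι ↪ Ω} {J : ∀ i, V →ₗ[F] H i} {A B : ι → X →ₗ[F] V}

theorem exists_forall_mem_injective [FiniteDimensional F V] [∀ i, FiniteDimensional F (H i)]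
    {S : Set Ω} (h : ∀ i ∈ S, Module.finrank F V ≤ Module.finrank F (H i)) :
    ∃ J : ∀ i, V →ₗ[F] H i, ∀ i ∈ S, Function.Injective (J i) := by
  have hex (i : Ω) : ∃ J : V →ₗ[F] H i, i ∈ S → Function.Injective J := by
    by_cases hi : i ∈ S
    · exact (finrank_le_iff_exists_linearMap.1 (h i hi)).imp fun _ hJ _ => hJ
    · exact ⟨0, fun h => (hi h).elim⟩
  exact Classical.skolem.1 hex

/-- The linear map whose component at `e o` is `A o` followed by `J (e o)`, and whose components
outside the range of `e` vanish. -/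
noncomputable def spread (e : ι ↪ Ω) (J : ∀ i, V →ₗ[F] H i) (A : ι → X →ₗ[F] V) :
    X →ₗ[F] (∀ i, H i) :=
  LinearMap.pi fun i => J i ∘ₗ Function.extend e A 0 i

theorem spread_apply_eq_zero_iff (hJ : ∀ i ∈ Set.range e, Function.Injective (J i)) (x : X)
    (o : ι) : spread e J A x (e o) = 0 ↔ A o x = 0 := by
  simp [spread, e.injective.extend_apply, map_eq_zero_iff _ (hJ (e o) ⟨o, rfl⟩)]

theorem spread_apply_of_notMem_range (x : X) {i : Ω} (hi : i ∉ Set.range e) :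
    spread e J A x i = 0 := by
  simp [spread, Function.extend_apply' _ _ _ hi]

variable [Fintype Ω] {P : PartialOrder Ω} {ω : Ω → ℝ}

theorem suppIdeal_spread_congr (hJ : ∀ i ∈ Set.range e, Function.Injective (J i)) {x y : X}
    (h : ∀ o, A o x = 0 ↔ A o y = 0) :
    suppIdeal P (spread e J A x) = suppIdeal P (spread e J A y) :=
  suppIdeal_congr fun i => by
    by_cases hi : i ∈ Set.range e
    · obtain ⟨o, rfl⟩ := hi
      rw [spread_apply_eq_zero_iff hJ, spread_apply_eq_zero_iff hJ, h]
    · rw [spread_apply_of_notMem_range _ hi, spread_apply_of_notMem_range _ hi]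

theorem mem_suppIdeal_spread_iff (hJ : ∀ i ∈ Set.range e, Function.Injective (J i)) {r : ℕ}
    (hlen : ∀ o, len P (e o) = r) (x : X) (o : ι) :
    e o ∈ suppIdeal P (spread e J A x) ↔ A o x ≠ 0 := by
  rw [mem_suppIdeal_iff_ne_zero, ne_eq, spread_apply_eq_zero_iff hJ]
  refine fun j hj => spread_apply_of_notMem_range x ?_
  rintro ⟨o', rfl⟩
  exact (len_strictMono hj).ne ((hlen o).trans (hlen o').symm)

theorem IsHierarchical.wt_eq_of_perm (hP : IsHierarchical P) (τ : Equiv.Perm Ω)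
    (hlen : ∀ i, len P (τ i) = len P i) (hω : ∀ i, ω (τ i) = ω i) {α β : ∀ i, H i}
    (h : ∀ i, β i = 0 ↔ α (τ i) = 0) : wt P ω β = wt P ω α :=
  WeightedPoset.wt_eq_of_perm τ hω
    (mem_suppIdeal_of_triangular (hP.orderIsoOfLen τ hlen) fun i _ => h i)

theorem IsHierarchical.wt_spread_eq (hP : IsHierarchical P) {r : ℕ} {c : ℝ}
    (hlen : ∀ o, len P (e o) = r) (hω : ∀ o, ω (e o) = c)
    (hJ : ∀ i ∈ Set.range e, Function.Injective (J i)) (π : Equiv.Perm ι) {x : X}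
    (h : ∀ o, B o x = 0 ↔ A (π o) x = 0) :
    wt P ω (spread e J B x) = wt P ω (spread e J A x) := by
  have hπ (o : ι) : π.viaEmbedding e (e o) = e (π o) := π.viaEmbedding_apply e o
  have hinv {Y : Type} {g : Ω → Y} {y : Y} (hg : ∀ o, g (e o) = y) (i : Ω) :
      g (π.viaEmbedding e i) = g i := by
    by_cases hi : i ∈ Set.range e
    · obtain ⟨o, rfl⟩ := hi
      rw [hπ, hg, hg]
    · rw [π.viaEmbedding_apply_of_notMem e i hi]
  refine hP.wt_eq_of_perm (π.viaEmbedding e) (hinv hlen) (hinv hω) fun i => ?_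
  by_cases hi : i ∈ Set.range e
  · obtain ⟨o, rfl⟩ := hi
    rw [hπ, spread_apply_eq_zero_iff hJ, spread_apply_eq_zero_iff hJ, h]
  · rw [π.viaEmbedding_apply_of_notMem e i hi, spread_apply_of_notMem_range x hi,
      spread_apply_of_notMem_range x hi]

end Spread

section Necessity

variable {Ω : Type*} [Fintype Ω] {F : Type*} [Field F] {H : Ω → Type*} [∀ i, AddCommGroup (H i)]
  [∀ i, Module F (H i)] {P : PartialOrder Ω} {ω : Ω → ℝ}

/-- With `|F| + 1` blocks on a level, the code of all `x ∈ F²` with the functionals of the pencil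
as components has the same weights as the one with `x` itself in all blocks but one. An isometry
between them would make the supports of the first code all generate the same ideal. -/
theorem IsHierarchical.not_MEP [∀ i, Nontrivial (H i)] [∀ i, FiniteDimensional F (H i)]
    (hP : IsHierarchical P) (hω : ∀ i, 0 < ω i) (e : Option F ↪ Ω) {r : ℕ} {c : ℝ}
    (hlen : ∀ o, len P (e o) = r) (hωe : ∀ o, ω (e o) = c)
    (hdim : ∀ o, 2 ≤ Module.finrank F (H (e o))) : ¬ MEP F H P ω := by
  intro hM
  obtain ⟨J, hJ⟩ := exists_forall_mem_injective (F := F) (V := F × F) (H := H) (S := Set.range e)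
    (Set.forall_mem_range.2 fun o => (Module.finrank_prod.trans (by simp)).trans_le (hdim o))
  let A : Option F → F × F →ₗ[F] F × F := fun o => LinearMap.inl F F F ∘ₗ pencil o
  let B : Option F → F × F →ₗ[F] F × F := fun o => if o = none then 0 else LinearMap.id
  have hA (o : Option F) (x : F × F) : A o x = 0 ↔ pencil o x = 0 :=
    map_eq_zero_iff _ LinearMap.inl_injective
  have hB (o : Option F) {x : F × F} (hx : x ≠ 0) : B o x = 0 ↔ o = none := by
    by_cases ho : o = none <;> simp [B, ho, hx]
  obtain ⟨ψ, hψ, hψA⟩ := hM.exists_isometry (a := spread e J A) (b := spread e J B) hω fun x => by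
    obtain rfl | hx := eq_or_ne x 0
    · rw [map_zero, map_zero]
    · obtain ⟨o, ho⟩ := exists_pencil_apply_eq_zero_iff hx
      refine hP.wt_spread_eq hlen hωe hJ (Equiv.swap o none) fun o' => ?_
      rw [hA, hB o' hx, ho, Equiv.swap_apply_eq_iff, Equiv.swap_apply_left]
  obtain ⟨l, hl⟩ := hψ.exists_orderIso hω
  have hmem (x : F × F) : l (e none) ∈ suppIdeal P (spread e J B x) ↔ pencil none x ≠ 0 := by
    rw [← hψA, hψ.mem_suppIdeal_apply_iff hω hl, mem_suppIdeal_spread_iff hJ hlen, ne_eq, hA]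
  have hB' : suppIdeal P (spread e J B (1, 0)) = suppIdeal P (spread e J B (0, 1)) :=
    suppIdeal_spread_congr hJ fun o => (hB o (by simp)).trans (hB o (by simp)).symm
  have hpencil : pencil none ((1, 0) : F × F) ≠ 0 ↔ pencil none ((0, 1) : F × F) ≠ 0 := by
    rw [← hmem, ← hmem, hB']
  simp [pencil] at hpencil

theorem numericCondition_of_mep [Fintype F] {k : Ω → ℕ} [∀ i, NeZero (k i)]
    (hω : ∀ i, 0 < ω i) (hP : IsHierarchical P) (hM : MEP F (fun i => Fin (k i) → F) P ω) :
    NumericCondition F k P ω := by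
  intro r _ _ c _
  by_contra! ⟨⟨i₀, hi₀, hc₀, hk₀⟩, hcard⟩
  have hD := conditionD_of_transitive hω (transitive_of_MEP hω hM)
  obtain ⟨e⟩ := Function.Embedding.nonempty_of_card_le (α := Option F)
    (β := {i | i ∈ level P r ∧ ω i = c}) (by
      rw [Fintype.card_option, ← Nat.card_eq_fintype_card (α := {i | i ∈ level P r ∧ ω i = c}),
        Nat.card_coe_set_eq]
      exact hcard)
  refine hP.not_MEP hω (e.trans (Function.Embedding.subtype _)) (fun o => (e o).2.1)
    (fun o => (e o).2.2) (fun o => ?_) hM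
  obtain ⟨g⟩ := hD.2 (e o) i₀ ((e o).2.1.trans hi₀.symm) ((e o).2.2.trans hc₀.symm)
  have hfinrank := g.finrank_eq
  simp only [Module.finrank_fin_fun] at hfinrank
  have := NeZero.ne (k i₀)
  change 2 ≤ Module.finrank F (Fin (k (e o)) → F)
  rw [Module.finrank_fin_fun]
  lia

end Necessity

end WeightedPoset

open WeightedPoset in
theorem theorem6p5_general {Ω : Type*} [Fintype Ω] {F : Type*} [Field F] [Fintype F]
    (P : PartialOrder Ω) (ω : Ω → ℝ) (hω : ∀ i, 0 < ω i)
    (k : Ω → ℕ) (hk : ∀ i, 0 < k i) (χ : AddChar F ℂ) (hχ : χ ≠ 1) :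
    (MEP F (fun i => Fin (k i) → F) P ω →
      IsometriesTransitive F (fun i => Fin (k i) → F) P ω) ∧
    (IsometriesTransitive F (fun i => Fin (k i) → F) P ω ↔
      ConditionD F (fun i => Fin (k i) → F) P ω) ∧
    (ConditionD F (fun i => Fin (k i) → F) P ω →
      weightPartition (fun i => Fin (k i) → F) (dualPoset P) ω =
        dualPartition χ
          (weightPartition (fun i => Fin (k i) → F) P ω)) ∧
    (weightPartition (fun i => Fin (k i) → F) (dualPoset P) ω =
        dualPartition χ
          (weightPartition (fun i => Fin (k i) → F) P ω) ↔
      AdmitsMacWilliamsIdentity F k P ω) ∧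
    (AdmitsMacWilliamsIdentity F k P ω →
      FourierReflexive χ
        (weightPartition (fun i => Fin (k i) → F) P ω)) ∧
    (IsHierarchical P →
      (MEP F (fun i => Fin (k i) → F) P ω ↔
        ConditionD F (fun i => Fin (k i) → F) P ω ∧
          NumericCondition F k P ω)) ∧
    (IsHierarchical P →
      List.TFAE
        [IsometriesTransitive F (fun i => Fin (k i) → F) P ω,
         ConditionD F (fun i => Fin (k i) → F) P ω,
         weightPartition (fun i => Fin (k i) → F) (dualPoset P) ω =
           dualPartition χ
             (weightPartition (fun i => Fin (k i) → F) P ω),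
         AdmitsMacWilliamsIdentity F k P ω,
         FourierReflexive χ
           (weightPartition (fun i => Fin (k i) → F) P ω)]) := by
  have : ∀ i, NeZero (k i) := fun i => ⟨(hk i).ne'⟩
  have h12 := transitive_of_MEP (F := F) (H := fun i => Fin (k i) → F) (P := P) hω
  have h23 : IsometriesTransitive F (fun i => Fin (k i) → F) P ω ↔
      ConditionD F (fun i => Fin (k i) → F) P ω :=
    ⟨conditionD_of_transitive hω, transitive_of_conditionD hω⟩
  have h34 := fun h : ConditionD F (fun i => Fin (k i) → F) P ω =>
    eq_dualPartition_of_le hχ (le_dualPartition_of_conditionD χ hω h)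
  have h45 := eq_dualPartition_iff_macWilliams (k := k) (P := P) hω hχ
  have h46 := fourierReflexive_of_eq_dualPartition (k := k) (P := P) (ω := ω) hχ
  refine ⟨h12, h23, h34, h45, fun h => h46 (h45.2 h), fun hP => ⟨fun h => ?_, fun h => ?_⟩,
    fun hP => ?_⟩
  · exact ⟨h23.1 (h12 h), numericCondition_of_mep hω hP h⟩
  · exact mep_of_conditionD hω hP h.1 h.2
  · tfae_have 1 ↔ 2 := h23
    tfae_have 2 → 3 := h34
    tfae_have 3 → 2 := fun h => conditionD_of_hierarchical hχ hω hP h.le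
    tfae_have 3 ↔ 4 := h45
    tfae_have 3 → 5 := h46
    tfae_have 5 → 3 := fun h =>
      eq_dualPartition_of_fourierReflexive hχ h (dualPartition_le_of_hierarchical hχ hω hP)
    tfae_finish

theorem theorem6p5 {Ω : Type*} [Fintype Ω] [Nonempty Ω] {F : Type*} [Field F] [Fintype F]
    (P : PartialOrder Ω) (ω : Ω → ℝ) (hω : ∀ i, 0 < ω i)
    (k : Ω → ℕ) (hk : ∀ i, 0 < k i) (χ : AddChar F ℂ) (hχ : χ ≠ 1) :
    (WeightedPoset.MEP F (fun i => Fin (k i) → F) P ω →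
      WeightedPoset.IsometriesTransitive F (fun i => Fin (k i) → F) P ω) ∧
    (WeightedPoset.IsometriesTransitive F (fun i => Fin (k i) → F) P ω ↔
      WeightedPoset.ConditionD F (fun i => Fin (k i) → F) P ω) ∧
    (WeightedPoset.ConditionD F (fun i => Fin (k i) → F) P ω →
      WeightedPoset.weightPartition (fun i => Fin (k i) → F) (WeightedPoset.dualPoset P) ω =
        WeightedPoset.dualPartition χ
          (WeightedPoset.weightPartition (fun i => Fin (k i) → F) P ω)) ∧
    (WeightedPoset.weightPartition (fun i => Fin (k i) → F) (WeightedPoset.dualPoset P) ω =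
        WeightedPoset.dualPartition χ
          (WeightedPoset.weightPartition (fun i => Fin (k i) → F) P ω) ↔
      WeightedPoset.AdmitsMacWilliamsIdentity F k P ω) ∧
    (WeightedPoset.AdmitsMacWilliamsIdentity F k P ω →
      WeightedPoset.FourierReflexive χ
        (WeightedPoset.weightPartition (fun i => Fin (k i) → F) P ω)) ∧
    (WeightedPoset.IsHierarchical P →
      (WeightedPoset.MEP F (fun i => Fin (k i) → F) P ω ↔
        WeightedPoset.ConditionD F (fun i => Fin (k i) → F) P ω ∧
          WeightedPoset.NumericCondition F k P ω)) ∧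
    (WeightedPoset.IsHierarchical P → (∀ i, ∃ z : ℤ, ω i = (z : ℝ)) →
      List.TFAE
        [WeightedPoset.IsometriesTransitive F (fun i => Fin (k i) → F) P ω,
         WeightedPoset.ConditionD F (fun i => Fin (k i) → F) P ω,
         WeightedPoset.weightPartition (fun i => Fin (k i) → F) (WeightedPoset.dualPoset P) ω =
           WeightedPoset.dualPartition χ
             (WeightedPoset.weightPartition (fun i => Fin (k i) → F) P ω),
         WeightedPoset.AdmitsMacWilliamsIdentity F k P ω,
         WeightedPoset.FourierReflexive χ
           (WeightedPoset.weightPartition (fun i => Fin (k i) → F) P ω)]) :=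
  have ⟨h12, h23, h34, h45, h56, hMEP, hTFAE⟩ :=
    theorem6p5_general P ω hω k hk χ hχ
  ⟨h12, h23, h34, h45, h56, hMEP, fun hP _ => hTFAE hP⟩
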